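/- Let $Y=U_0\cup_\Sigma U_1$ be a genus $g\ge 1$ Heegaard splitting of a closed oriented three-manifold, where $\Sigma$ is a closed connected oriented smooth surface of genus $g$, and let $\alpha_1,\dots,\alpha_g$ and $\beta_1,\dots,\beta_g$ be complete sets of oriented attaching circles in $\Sigma$ for the handlebodies $U_0$ and $U_1$, with every $\alpha_k$ transverse to every $\beta_l$. Put $H=H_1(Y;\mathbb Z)$ and $\underline H=H/\mathrm{Tors}$, and let $G$ be one of the groups $\underline H$, $H$ (written multiplicatively in the group ring $\mathbb Z[G]$). *Intersection polynomials.* Let $P\to \mathrm{Sym}^{g-1}(\Sigma)$ be the regular covering space with deck group $G$ that corresponds to $\pi_1(\mathrm{Sym}^{g-1}(\Sigma))\to H_1(\mathrm{Sym}^{g-1}(\Sigma))\cong H_1(\Sigma)\to H_1(Y)\to G$ (for $g=1$, where $\mathrm{Sym}^0(\Sigma)$ is a point, this is the trivial covering $G\to \mathrm{pt}$). For $1\le i,j\le g$ let $$T_i(\alpha)=\alpha_1\times\dots\times\widehat{\alpha_i}\times\dots\times\alpha_g,\qquad T_j(\beta)=\beta_1\times\dots\times\widehat{\beta_j}\times\dots\times\beta_g$$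 be the tori in $\mathrm{Sym}^{g-1}(\Sigma)$, oriented as products. Given lifts $\widetilde T_i(\alpha)$, $\widetilde T_j(\beta)$ of these tori to $P$, set $$C_{i,j}=\sum_{h\in G}\#\bigl(\widetilde T_j(\beta)\cap h\,\widetilde T_i(\alpha)\bigr)[h]\in\mathbb Z[G],$$ where $\#$ is the signed number of intersection points. Write $\underline C_{i,j}$ for $C_{i,j}$ if $G=\underline H$. *Minors.* The splitting gives a CW structure on $Y$ with one 0-cell, one 1-cell for each one-handle of $U_0$ (dual to $\alpha_1,\dots,\alpha_g$), one 2-cell for each disc of $U_1$ bounded by $\beta_1,\dots,\beta_g$, and one 3-cell. Let $\widetilde Y\to Y$ be the regular covering space with deck group $G$ that corresponds to $\pi_1(Y)\to H_1(Y)\to G$, and choose a lift of each 1-cell and each 2-cell to $\widetilde Y$. With respect to these lifts the cellular boundary map $C_2(\widetilde Y)\to C_1(\widetilde Y)$ is a $g\times g$ matrix over $\mathbb Z[G]$, with rows indexed by the 1-cells and columns by the 2-cells; let $\Delta_{i,j}$ be the determinant of the matrix obtained from it by deleting row $i$ and column $j$. Write $\underline\Delta_{i,j}$ for $\Delta_{i,j}$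 if $G=\underline H$. The *Alexander polynomial* of $Y$ (defined up to units of $\mathbb Z[\underline H]$) is the greatest common divisor of the $\underline\Delta_{i,j}$, $1\le i,j\le g$. Then, for $G=\underline H$ and for $G=H$, and for every choice of the lifted cells, there is a sign $\varepsilon\in\{\pm1\}$, independent of $i,j$, such that: 1. there are lifts of the tori $T_1(\alpha),\dots,T_g(\alpha),T_1(\beta),\dots,T_g(\beta)$ to $P$ for which $C_{i,j}=\varepsilon\,\Delta_{i,j}$ for all $i,j$; 2. for any lifts of these tori there are $u_1,\dots,u_g,v_1,\dots,v_g\in G$ with $C_{i,j}=\varepsilon\,[u_iv_j]\,\Delta_{i,j}$ for all $i,j$. Moreover, for $G=\underline H$ and any lifts of the tori, an element of $\mathbb Z[\underline H]$ is the Alexander polynomial of $Y$ if and only if it is a greatest common divisor of the $\underline C_{i,j}$, $1\le i,j\le g$. -/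

import Mathlib

open scoped Manifold ContDiff

noncomputable section

universe w

namespace Heegaard

/-! ### Plane vectors, oriented surfaces, closed curves -/

/-- The determinant of two vectors of the oriented plane. -/
def cross (v w : EuclideanSpace ℝ (Fin 2)) : ℝ := v 0 * w 1 - v 1 * w 0

/-- All transition maps of the given atlas of a surface preserve the orientation of the plane;
the surface is then oriented by its charts. -/
def IsOrientedAtlas (F : Type*) [TopologicalSpace F]
    [ChartedSpace (EuclideanSpace ℝ (Fin 2)) F] : Prop :=
  ∀ e ∈ atlas (EuclideanSpace ℝ (Fin 2)) F, ∀ e' ∈ atlas (EuclideanSpace ℝ (Fin 2)) F,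
    ∀ x ∈ (e.symm.trans e').source, 0 < (fderiv ℝ (e.symm.trans e') x).det

/-- The velocity of a closed curve (parametrised by `ℝ/ℤ`) on a surface at the parameter `θ`, in
the preferred chart at the point of the curve. -/
def velocity {F : Type*} [TopologicalSpace F] [ChartedSpace (EuclideanSpace ℝ (Fin 2)) F]
    (γ : UnitAddCircle → F) (θ : UnitAddCircle) : EuclideanSpace ℝ (Fin 2) :=
  mfderiv 𝓘(ℝ, ℝ) (𝓡 2) (fun r : ℝ => γ (θ + (r : UnitAddCircle))) 0 (1 : ℝ)

/-! ### Handlebodies and Heegaard splittings -/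

/-- The closed unit disc. -/
abbrev Disc : Type := Metric.closedBall (0 : ℂ) 1

/-- The closed unit ball of dimension three. -/
abbrev Ball3 : Type := Metric.closedBall (0 : EuclideanSpace ℝ (Fin 3)) 1

/-- The interval `[-1, 1]`. -/
abbrev Core : Type := Set.Icc (-1 : ℝ) 1

/-- The midpoint of `[-1, 1]`. -/
def Core.mid : Core := ⟨0, by norm_num, by norm_num⟩

/-- The standard parametrisation of the boundary circle of the disc by `ℝ/ℤ`. -/
def discBoundary (θ : UnitAddCircle) : Disc :=
  ⟨(AddCircle.toCircle θ : ℂ), by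
    rw [mem_closedBall_zero_iff, Circle.norm_coe]⟩

/-- A genus `g` handlebody inside `Y` with boundary the embedded surface `ι : F → Y`: a 0-handle
(a closed ball) with `g` one-handles `D² × [-1,1]`, disjoint from each other, attached along
`D² × {±1}` to the boundary sphere of the ball. The boundary annulus `∂D² × [-1,1]` of each
one-handle lies on the surface; there it is a smooth annulus `collar`, positively oriented by
`(∂/∂t, ∂/∂θ)`. The boundaries of the cocore discs `D² × {0}` are the attaching circles: turned
upside down, the handlebody arises from the surface by attaching two-handles along these circles
and then one three-handle (the ball). -/
structure Handlebody {F Y : Type*} [TopologicalSpace F] [TopologicalSpace Y]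
    [ChartedSpace (EuclideanSpace ℝ (Fin 2)) F] (ι : F → Y) (g : ℕ) where
  ball : C(Ball3, Y)
  handle : Fin g → C(Disc × Core, Y)
  collar : Fin g → UnitAddCircle → ℝ → F
  ball_injective : Function.Injective ball
  handle_injective : Function.Injective (fun z : Fin g × (Disc × Core) => handle z.1 z.2)
  handle_mem_ball_iff : ∀ k z, handle k z ∈ Set.range ball ↔ |(z.2 : ℝ)| = 1
  norm_of_ball_mem_handle : ∀ k x, ball x ∈ Set.range (handle k) →
    ‖(x : EuclideanSpace ℝ (Fin 3))‖ = 1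
  handle_mem_surface_iff : ∀ k z, handle k z ∈ Set.range ι ↔ ‖(z.1 : ℂ)‖ = 1
  ball_mem_surface_iff : ∀ x, ball x ∈ Set.range ι ↔
    ‖(x : EuclideanSpace ℝ (Fin 3))‖ = 1 ∧ ∀ k z, ‖(z.1 : ℂ)‖ < 1 → handle k z ≠ ball x
  surface_subset : Set.range ι ⊆ Set.range ball ∪ ⋃ k, Set.range (handle k)
  handle_boundary : ∀ k θ (t : Core), handle k (discBoundary θ, t) = ι (collar k θ t)
  collar_smooth : ∀ k, ContMDiffOn 𝓘(ℝ, ℝ × ℝ) (𝓡 2) ∞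
    (fun z : ℝ × ℝ => collar k (z.1 : UnitAddCircle) z.2) (Set.univ ×ˢ Set.Ioo (-1) 1)
  collar_oriented : ∀ k (θ : ℝ), ∀ t ∈ Set.Ioo (-1 : ℝ) 1,
    0 < cross
      (mfderiv 𝓘(ℝ, ℝ × ℝ) (𝓡 2)
        (fun z : ℝ × ℝ => collar k (z.1 : UnitAddCircle) z.2) (θ, t) ((0, 1) : ℝ × ℝ))
      (mfderiv 𝓘(ℝ, ℝ × ℝ) (𝓡 2)
        (fun z : ℝ × ℝ => collar k (z.1 : UnitAddCircle) z.2) (θ, t) ((1, 0) : ℝ × ℝ))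

namespace Handlebody

variable {F Y : Type*} [TopologicalSpace F] [TopologicalSpace Y]
  [ChartedSpace (EuclideanSpace ℝ (Fin 2)) F] {ι : F → Y} {g : ℕ}

/-- The subset of `Y` filled by the handlebody. -/
def carrier (U : Handlebody ι g) : Set Y :=
  Set.range U.ball ∪ ⋃ k, Set.range (U.handle k)

/-- The `k`-th attaching circle, with its orientation. -/
def circle (U : Handlebody ι g) (k : Fin g) (θ : UnitAddCircle) : F := U.collar k θ 0

/-- The disc `D² × {0}` in the handlebody bounded by the `k`-th attaching circle. -/
def disc (U : Handlebody ι g) (k : Fin g) (x : Disc) : Y := U.handle k (x, Core.mid)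

end Handlebody

/-- A genus `g` Heegaard splitting `Y = U₀ ∪ U₁` along the surface `F`, with complete sets of
attaching circles for both handlebodies. Such a `Y`, if Hausdorff, is automatically a closed
orientable three-manifold. -/
structure HeegaardSplitting (F Y : Type*) [TopologicalSpace F] [TopologicalSpace Y]
    [ChartedSpace (EuclideanSpace ℝ (Fin 2)) F] (g : ℕ) where
  ι : C(F, Y)
  embedding : Topology.IsEmbedding ι
  U₀ : Handlebody ι g
  U₁ : Handlebody ι g
  union_eq : U₀.carrier ∪ U₁.carrier = Set.univ
  inter_eq : U₀.carrier ∩ U₁.carrier = Set.range ι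

namespace HeegaardSplitting

variable {F Y : Type*} [TopologicalSpace F] [TopologicalSpace Y]
  [ChartedSpace (EuclideanSpace ℝ (Fin 2)) F] {g : ℕ}

/-- The attaching circles of the first handlebody. -/
def α (S : HeegaardSplitting F Y g) : Fin g → UnitAddCircle → F := S.U₀.circle

/-- The attaching circles of the second handlebody. -/
def β (S : HeegaardSplitting F Y g) : Fin g → UnitAddCircle → F := S.U₁.circle

/-- Every `α` circle is transverse to every `β` circle. -/
def Transverse (S : HeegaardSplitting F Y g) : Prop :=
  ∀ k l s t, S.β k s = S.α l t → cross (velocity (S.β k) s) (velocity (S.α l) t) ≠ 0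

end HeegaardSplitting

/-! ### Symmetric products -/

/-- Two `n`-tuples are equivalent if they differ by a permutation of the entries. -/
def symSetoid (n : ℕ) (X : Type*) : Setoid (Fin n → X) where
  r x y := ∃ σ : Equiv.Perm (Fin n), y = x ∘ σ
  iseqv :=
    { refl := fun x => ⟨1, rfl⟩
      symm := by
        rintro x y ⟨σ, rfl⟩
        exact ⟨σ⁻¹, by ext i; simp⟩
      trans := by
        rintro x y z ⟨σ, rfl⟩ ⟨τ, rfl⟩
        exact ⟨σ * τ, rfl⟩ }

/-- The `n`-fold symmetric product of `X`. -/
def SymProd (n : ℕ) (X : Type*) : Type _ := Quotient (symSetoid n X)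

/-- The unordered tuple of an ordered one. -/
def SymProd.mk {n : ℕ} {X : Type*} (x : Fin n → X) : SymProd n X :=
  Quotient.mk (symSetoid n X) x

/-- The symmetric product carries the quotient topology of the cartesian power. -/
instance (n : ℕ) (X : Type*) [TopologicalSpace X] : TopologicalSpace (SymProd n X) :=
  inferInstanceAs (TopologicalSpace (Quotient (symSetoid n X)))

/-! ### Homology and abelian covers -/

/-- The first integral homology group (written multiplicatively) of a path connected space,
with the Hurewicz homomorphism `Abelianization.of` from the fundamental group. -/
abbrev H1 (Y : Type*) [TopologicalSpace Y] (y : Y) : Type _ :=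
  Abelianization (FundamentalGroup Y y)

/-- The first integral homology group modulo torsion. -/
abbrev H1free (Y : Type*) [TopologicalSpace Y] (y : Y) : Type _ :=
  H1 Y y ⧸ CommGroup.torsion (H1 Y y)

/-- The Hurewicz homomorphism. -/
def hurewicz (Y : Type*) [TopologicalSpace Y] (y : Y) : FundamentalGroup Y y →* H1 Y y :=
  Abelianization.of

/-- The Hurewicz homomorphism followed by the quotient by torsion. -/
def hurewiczFree (Y : Type*) [TopologicalSpace Y] (y : Y) :
    FundamentalGroup Y y →* H1free Y y :=
  (QuotientGroup.mk' (CommGroup.torsion (H1 Y y))).comp (hurewicz Y y)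

/-- `p : E → Y` is the regular covering space with deck group `G` that corresponds to the
homomorphism `φ : π₁(Y, y) → G`: the lift of a loop `γ` starting at a point `e` ends at `φ[γ] • e`.
For surjective `φ` it is the connected cover that belongs to the kernel of `φ`. -/
structure IsCoverOf {G E Y : Type*} [CommGroup G] [TopologicalSpace E] [MulAction G E]
    [TopologicalSpace Y] (p : E → Y) (y : Y) (φ : FundamentalGroup Y y →* G) : Prop where
  isQuotientCoveringMap : IsQuotientCoveringMap p G
  monodromy : ∀ (γ : Path y y) (Γ : C(unitInterval, E)), (∀ r, p (Γ r) = γ r) →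
    Γ 1 = φ (FundamentalGroup.fromPath (Path.Homotopic.Quotient.mk γ)) • Γ 0

/-- `q : P → Symⁿ(F)` is the regular covering space with deck group `G` that corresponds to
`π₁(Symⁿ F) → H₁(Symⁿ F) ≅ H₁(F) → G`, where the last map is induced by `ι : F → Y` and
`φ : π₁(Y) → G`. Loops `r ↦ {γ₁(r), …, γₙ(r)}` at `{x₀, …, x₀}`, where the `γ_k` are loops in `F`,
represent all classes of `π₁(Symⁿ F)`, and the homology class of such a loop corresponds
to the sum of the classes of the `γ_k` in `H₁(F)`. -/
structure IsSymCoverOf {G P F Y : Type*} [CommGroup G] [TopologicalSpace P] [MulAction G P]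
    [TopologicalSpace F] [TopologicalSpace Y] {n : ℕ} (q : P → SymProd n F) (ι : C(F, Y)) (x₀ : F)
    (φ : FundamentalGroup Y (ι x₀) →* G) : Prop where
  isQuotientCoveringMap : IsQuotientCoveringMap q G
  monodromy : ∀ (γ : Fin n → Path x₀ x₀) (Γ : C(unitInterval, P)),
    (∀ r, q (Γ r) = SymProd.mk fun k => γ k r) →
    Γ 1 = (∏ k, φ (FundamentalGroup.fromPath
      (Path.Homotopic.Quotient.mk ((γ k).map ι.continuous)))) • Γ 0

/-! ### The cellular boundary map of the Heegaard CW complex -/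

/-- The degree of a continuous map of the circle `ℝ/ℤ` to itself: `Φ 1 - Φ 0` for any lift
`Φ : ℝ → ℝ`. -/
def circleDegree (f : UnitAddCircle → UnitAddCircle) : ℤ :=
  Classical.epsilon fun d : ℤ => ∃ Φ : ℝ → ℝ, Continuous Φ ∧
    (∀ r : ℝ, ((Φ r : ℝ) : UnitAddCircle) = f (r : UnitAddCircle)) ∧ Φ 1 = Φ 0 + d

open Classical in
/-- Given an embedded one-handle `a : D² × [-1,1] → E`, project it to its core `[-1,1]`, collapse
the complement of the open one-cell `(-1,1)` to a point, and identify the resulting circle with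
`ℝ/ℤ` (through `t ↦ (t + 1) / 2`, the base point being `0`). -/
def pinch {E : Type*} (a : Disc × Core → E) (y : E) : UnitAddCircle :=
  if h : ∃ z, a z = y then ((((h.choose.2 : ℝ) + 1) / 2 : ℝ) : UnitAddCircle) else 0

/-- The incidence number of a two-cell `b` with the one-cell given by the core of the one-handle
`a`: the degree of the attaching circle of `b` on the circle obtained from the one-skeleton by
collapsing the complement of the open one-cell. -/
def incidence {E : Type*} (a : Disc × Core → E) (b : Disc → E) : ℤ :=
  circleDegree fun θ => pinch a (b (discBoundary θ))

/-- The covers of `Y` and of `Symⁿ(F)` that correspond to a homomorphism `φ` from `π₁(Y)` to an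
abelian group `G`, and a fundamental family of cells in the cover of `Y`.

The Heegaard CW complex: collapsing the 0-handle of `U₀` to a point and each one-handle of `U₀` to
its core turns the Heegaard splitting into a CW complex with one zero-cell, one one-cell for each
one-handle of `U₀`, one two-cell for each disc of `U₁` bounded by a `β` circle, and one three-cell.
Its cells are lifted to the cover through lifts of the one-handles and of the discs. -/
structure EquivariantModel {F Y : Type*} [TopologicalSpace F] [TopologicalSpace Y]
    [ChartedSpace (EuclideanSpace ℝ (Fin 2)) F] {n : ℕ} (S : HeegaardSplitting F Y (n + 1))
    (x₀ : F) {G : Type*} [CommGroup G] (φ : FundamentalGroup Y (S.ι x₀) →* G) where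
  /-- the cover of `Y` -/
  E : Type w
  [topE : TopologicalSpace E]
  [actE : MulAction G E]
  p : E → Y
  isCover : IsCoverOf p (S.ι x₀) φ
  /-- the cover of the symmetric product -/
  P : Type w
  [topP : TopologicalSpace P]
  [actP : MulAction G P]
  q : P → SymProd n F
  isSymCover : IsSymCoverOf q S.ι x₀ φ
  /-- the lifted one-handles, whose cores are the lifted one-cells -/
  a : Fin (n + 1) → C(Disc × Core, E)
  a_lifts : ∀ k z, p (a k z) = S.U₀.handle k z
  /-- the lifted two-cells -/
  b : Fin (n + 1) → C(Disc, E)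
  b_lifts : ∀ k x, p (b k x) = S.U₁.disc k x

namespace EquivariantModel

attribute [instance] EquivariantModel.topE EquivariantModel.actE
attribute [instance] EquivariantModel.topP EquivariantModel.actP

variable {F Y : Type*} [TopologicalSpace F] [TopologicalSpace Y]
  [ChartedSpace (EuclideanSpace ℝ (Fin 2)) F] {n : ℕ} {S : HeegaardSplitting F Y (n + 1)}
  {x₀ : F} {G : Type*} [CommGroup G] {φ : FundamentalGroup Y (S.ι x₀) →* G}

/-- The matrix over `ℤ[G]` of the cellular boundary map from two-chains to one-chains of the
cover: `∂ b_k = ∑_l D_{l,k} a_l`, where the coefficient of `[h]` in `D_{l,k}` is the incidence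
number of the two-cell `b_k` with the one-cell `h • a_l`. -/
def boundaryMatrix (M : EquivariantModel S x₀ φ) :
    Matrix (Fin (n + 1)) (Fin (n + 1)) (MonoidAlgebra ℤ G) :=
  Matrix.of fun l k => ∑ᶠ h : G,
    MonoidAlgebra.single h (incidence (fun z => h • M.a l z) (M.b k))

/-- The minor `Δ_{i,j}` of the boundary matrix: delete row `i` and column `j`, and take the
determinant. -/
def Δ (M : EquivariantModel S x₀ φ) (i j : Fin (n + 1)) : MonoidAlgebra ℤ G :=
  (M.boundaryMatrix.submatrix i.succAbove j.succAbove).det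

/-! ### Intersection polynomials of lifted tori -/

/-- `A` is a lift of the torus `T_i(α) = α₁ × … × α̂_i × … × α_g`. -/
def IsLiftα (M : EquivariantModel S x₀ φ) (i : Fin (n + 1))
    (A : (Fin n → UnitAddCircle) → M.P) : Prop :=
  Continuous A ∧ ∀ t, M.q (A t) = SymProd.mk fun k => S.α (i.succAbove k) (t k)

/-- `B` is a lift of the torus `T_j(β) = β₁ × … × β̂_j × … × β_g`. -/
def IsLiftβ (M : EquivariantModel S x₀ φ) (j : Fin (n + 1))
    (B : (Fin n → UnitAddCircle) → M.P) : Prop :=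
  Continuous B ∧ ∀ s, M.q (B s) = SymProd.mk fun k => S.β (j.succAbove k) (s k)

end EquivariantModel

open Classical in
/-- Let `D = {x₁, …, xₙ}`, `x_m = α_m(t_m)`, be a point where the tori
`β₁ × … × βₙ` (at the parameter `s`) and `α₁ × … × αₙ` (at the parameter `t`) in the symmetric
product meet; the `x_m` are distinct, and the tangent space of the symmetric product at `D` is
`⨁_m T_{x_m} F`. The columns of this matrix are the tangent vectors of the `β` torus followed by
those of the `α` torus, in the coordinates of that direct sum given by the charts at the `x_m`. -/
def tangentMatrix {F : Type*} [TopologicalSpace F] [ChartedSpace (EuclideanSpace ℝ (Fin 2)) F]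
    {n : ℕ} (β α : Fin n → UnitAddCircle → F) (s t : Fin n → UnitAddCircle) :
    Matrix (Fin n × Fin 2) (Fin n ⊕ Fin n) ℝ :=
  Matrix.of fun mc => Sum.elim
    (fun k => if β k (s k) = α mc.1 (t mc.1) then velocity (β k) (s k) mc.2 else 0)
    (fun k => if k = mc.1 then velocity (α k) (t k) mc.2 else 0)

/-- The local intersection number of the `β` torus with the `α` torus at a point where they meet:
the sign of the basis formed by an oriented basis of the tangent space of the first torus and one
of the second, with respect to the product orientation. -/
def localSign {F : Type*} [TopologicalSpace F] [ChartedSpace (EuclideanSpace ℝ (Fin 2)) F]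
    {n : ℕ} (β α : Fin n → UnitAddCircle → F) (s t : Fin n → UnitAddCircle) : ℤ :=
  (SignType.sign (((tangentMatrix β α s t).submatrix
    (fun r : Fin (n * 2) => finProdFinEquiv.symm r)
    (fun c : Fin (n * 2) =>
      finSumFinEquiv.symm (Fin.cast (Nat.mul_two n) c))).det) : ℤ)

namespace EquivariantModel

variable {F Y : Type*} [TopologicalSpace F] [TopologicalSpace Y]
  [ChartedSpace (EuclideanSpace ℝ (Fin 2)) F] {n : ℕ} {S : HeegaardSplitting F Y (n + 1)}
  {x₀ : F} {G : Type*} [CommGroup G] {φ : FundamentalGroup Y (S.ι x₀) →* G}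

/-- The intersection number `#(B ∩ h A)` of lifts `B`, `A` of `T_j(β)`, `T_i(α)`. -/
def intersectionNumber (M : EquivariantModel S x₀ φ) (i j : Fin (n + 1))
    (A B : (Fin n → UnitAddCircle) → M.P) (h : G) : ℤ :=
  ∑ᶠ (z : (Fin n → UnitAddCircle) × (Fin n → UnitAddCircle)) (_ : B z.1 = h • A z.2),
    localSign (fun k => S.β (j.succAbove k)) (fun k => S.α (i.succAbove k)) z.1 z.2

/-- The intersection polynomial `C_{i,j} = ∑_h #(B ∩ h A) [h]` of lifts `A`, `B` of `T_i(α)`,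
`T_j(β)`. -/
def C (M : EquivariantModel S x₀ φ) (i j : Fin (n + 1))
    (A B : (Fin n → UnitAddCircle) → M.P) : MonoidAlgebra ℤ G :=
  ∑ᶠ h : G, MonoidAlgebra.single h (M.intersectionNumber i j A B h)

end EquivariantModel

/-- `d` is a greatest common divisor of the family `x`. -/
def IsGCD {R ι : Type*} [CommRing R] (x : ι → R) (d : R) : Prop :=
  (∀ i, d ∣ x i) ∧ ∀ e, (∀ i, e ∣ x i) → e ∣ d

/-- `d` is the Alexander polynomial of `Y` (defined up to units): a greatest common divisor of the
minors of the boundary matrix of the maximal free abelian cover. -/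
def IsAlexanderPolynomial {F Y : Type*} [TopologicalSpace F] [TopologicalSpace Y]
    [ChartedSpace (EuclideanSpace ℝ (Fin 2)) F] {n : ℕ} {S : HeegaardSplitting F Y (n + 1)}
    {x₀ : F} (M : EquivariantModel S x₀ (hurewiczFree Y (S.ι x₀)))
    (d : MonoidAlgebra ℤ (H1free Y (S.ι x₀))) : Prop :=
  IsGCD (fun ij : Fin (n + 1) × Fin (n + 1) => M.Δ ij.1 ij.2) d

end Heegaard

end

open Heegaard

/-!
Both sides of the identity count the same things. A crossing of `β_k` with `α_l` has a sign and, as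
the lifts of the two curves to the cover of `Y` differ there by a deck transformation, an element of
`G`. The entries of the boundary matrix are the sums of these signed elements over the crossings
(`EquivariantModel.boundaryMatrix_eq_sum`): the incidence number is the degree of a circle map, and
this degree is the signed number of preimages of the value taken on the core of the annulus
(`circleDegree_eq_sum`, `EquivariantModel.incidence_eq_sum`). The sign of a preimage is found in
the coordinates of the annulus, by the inverse function theorem and the orientation of the collar.
On both sides of the identity the signs are read off in the chart at the crossing itself, so that no
two charts have to be compared.

Expanding the minor, one obtains a sum over a permutation `σ` and a choice of a crossing of `β_k`
with `α_{σ k}` for each `k`. These data are exactly the intersection points of the two tori. The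
tangent matrix at such a point is block diagonal up to a permutation of its columns, which gives the
local sign as the product of the sign of `σ`, the signs of the crossings, and the sign of a shuffle
that depends only on the genus (`localSign_eq`).

It remains to compare the elements of `G`. Points of the pullback `ι^* E` of the cover of `Y` to the
surface can be multiplied to a point of the cover `P` of the symmetric product: join them to a base
point and lift the resulting path of unordered tuples to `P`. The monodromy conditions say that the
result does not depend on the paths (`IsProductLift.unique`). The product is continuous, symmetric
and equivariant along the multiplication of `G`, so that the products of the lifted circles are
lifts of the tori for which the element of `G` at an intersection point is the product of those of
its crossings (`EquivariantModel.exists_product_lifts`). All other lifts are translates of these.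
-/

noncomputable section

namespace Heegaard

open Topology

/-! ### Lifting unordered tuples -/

section ProductLift

variable {G E P F Y : Type*} [CommGroup G] [TopologicalSpace E] [MulAction G E]
  [TopologicalSpace P] [MulAction G P] [TopologicalSpace F] [TopologicalSpace Y] {n : ℕ}

theorem exists_path_lift {X : Type*} [TopologicalSpace X] {f : E → X} (hf : IsCoveringMap f)
    {x y : X} (γ : Path x y) {e : E} (he : f e = x) :
    ∃ (e' : E) (L : Path e e'), ∀ r, f (L r) = γ r := by
  obtain ⟨Γ, h, h0⟩ := hf.exists_path_lifts (γ : C(unitInterval, X)) e (by simp [he])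
  exact ⟨Γ 1, ⟨Γ, h0, rfl⟩, fun r => congrFun h r⟩

theorem exists_path_lift_to {X : Type*} [TopologicalSpace X] {f : E → X} (hf : IsCoveringMap f)
    {x y : X} (γ : Path x y) {e : E} (he : f e = y) :
    ∃ (e' : E) (L : Path e' e), ∀ r, f (L r) = γ r := by
  obtain ⟨e', L, hL⟩ := exists_path_lift hf γ.symm he
  exact ⟨e', L.symm, fun r => by simp [Path.symm, hL]⟩

variable (G) in
/-- Let `p : E → Y` and `q : P → Symⁿ(F)` be covers with deck group `G` and base points `e₀`, `p₀`
over `ι x₀` and `{x₀, …, x₀}`, and let `z₁, …, z_n` be points of the cover `ι^* E` of `F`. The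
point `Q` of `P` is the product of the `z_k` if there are paths in `ι^* E` from translates
`g_k • e₀` of the base point to the `z_k` such that the path in `Symⁿ(F)` below them lifts to a path
in `P` from `(∏ g_k) • p₀` to `Q`. -/
def IsProductLift (p : E → Y) (q : P → SymProd n F) (ι : C(F, Y)) (x₀ : F) (e₀ : E) (p₀ : P)
    (z : Fin n → F × E) (Q : P) : Prop :=
  ∃ (g : Fin n → G) (η : ∀ k, Path x₀ (z k).1) (L : ∀ k, Path (g k • e₀) (z k).2)
    (Γ : Path ((∏ k, g k) • p₀) Q),
    (∀ k r, p (L k r) = ι (η k r)) ∧ ∀ r, q (Γ r) = SymProd.mk fun k => η k r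

theorem continuous_symProd_mk : Continuous (SymProd.mk : (Fin n → F) → SymProd n F) :=
  continuous_quotient_mk'

omit [TopologicalSpace F] in
theorem SymProd.mk_comp_perm (x : Fin n → F) (σ : Equiv.Perm (Fin n)) :
    SymProd.mk (x ∘ σ) = SymProd.mk x :=
  (Quotient.sound ⟨σ, rfl⟩ : Quotient.mk (symSetoid n F) x = Quotient.mk _ (x ∘ σ)).symm

variable {p : E → Y} {q : P → SymProd n F} {ι : C(F, Y)} {x₀ : F} {e₀ : E} {p₀ : P}
  {φ : FundamentalGroup Y (ι x₀) →* G}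

namespace IsProductLift

theorem apply_eq {z : Fin n → F × E} {Q : P} (h : IsProductLift G p q ι x₀ e₀ p₀ z Q) :
    q Q = SymProd.mk fun k => (z k).1 := by
  obtain ⟨g, η, L, Γ, hL, hΓ⟩ := h
  simpa using hΓ 1

theorem exists_of_lifts [PathConnectedSpace F] (hE : IsCoverOf p (ι x₀) φ)
    (hP : IsSymCoverOf q ι x₀ φ) (he₀ : p e₀ = ι x₀) (hp₀ : q p₀ = SymProd.mk fun _ => x₀)
    (z : Fin n → F × E) (hz : ∀ k, p (z k).2 = ι (z k).1) :
    ∃ Q, IsProductLift G p q ι x₀ e₀ p₀ z Q := by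
  have η : ∀ k, Path x₀ (z k).1 := fun k => (PathConnectedSpace.joined x₀ (z k).1).somePath
  have h1 : ∀ k, ∃ (g : G) (L : Path (g • e₀) (z k).2), ∀ r, p (L r) = ι (η k r) := by
    intro k
    obtain ⟨e', L, hL⟩ := exists_path_lift_to hE.isQuotientCoveringMap.isCoveringMap
      ((η k).map ι.continuous) (hz k)
    have : p e' = p e₀ := by simpa [he₀] using hL 0
    obtain ⟨g, rfl⟩ := hE.isQuotientCoveringMap.apply_eq_iff_mem_orbit.1 this
    exact ⟨g, L, hL⟩
  choose g L hL using h1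
  let γ : Path (SymProd.mk fun _ : Fin n => x₀) (SymProd.mk fun k => (z k).1) :=
    (Path.pi η).map continuous_symProd_mk
  obtain ⟨Q, Γ, hΓ⟩ := exists_path_lift hP.isQuotientCoveringMap.isCoveringMap γ
    (e := (∏ k, g k) • p₀) (by rw [hP.isQuotientCoveringMap.map_smul, hp₀])
  exact ⟨Q, g, η, L, Γ, hL, hΓ⟩

theorem smul (hE : IsCoverOf p (ι x₀) φ) (hP : IsSymCoverOf q ι x₀ φ)
    {z : Fin n → F × E} {Q : P} (hQ : IsProductLift G p q ι x₀ e₀ p₀ z Q) (h : Fin n → G) :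
    IsProductLift G p q ι x₀ e₀ p₀ (fun k => ((z k).1, h k • (z k).2)) ((∏ k, h k) • Q) := by
  obtain ⟨g, η, L, Γ, hL, hΓ⟩ := hQ
  have cE := hE.isQuotientCoveringMap.continuous_const_smul
  have cP := hP.isQuotientCoveringMap.continuous_const_smul
  refine ⟨fun k => h k * g k, η, fun k => ((L k).map (cE (h k))).cast (mul_smul ..) rfl,
    (Γ.map (cP (∏ k, h k))).cast (by rw [Finset.prod_mul_distrib, mul_smul]) rfl, ?_, ?_⟩
  · intro k r
    simpa [hE.isQuotientCoveringMap.map_smul] using hL k r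
  · intro r
    simpa [hP.isQuotientCoveringMap.map_smul] using hΓ r

theorem comp_perm {z : Fin n → F × E} {Q : P} (hQ : IsProductLift G p q ι x₀ e₀ p₀ z Q)
    (σ : Equiv.Perm (Fin n)) : IsProductLift G p q ι x₀ e₀ p₀ (z ∘ σ) Q := by
  obtain ⟨g, η, L, Γ, hL, hΓ⟩ := hQ
  refine ⟨g ∘ σ, fun k => η (σ k), fun k => L (σ k),
    Γ.cast (by rw [← Equiv.prod_comp σ g]; rfl) rfl, fun k => hL (σ k), fun r => ?_⟩
  rw [Path.cast_coe, hΓ, ← SymProd.mk_comp_perm _ σ]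
  rfl

theorem trans {z z' : Fin n → F × E} {Q Q' : P} (hQ : IsProductLift G p q ι x₀ e₀ p₀ z Q)
    (δ : ∀ k, Path (z k).1 (z' k).1) (M : ∀ k, Path (z k).2 (z' k).2) (Δ : Path Q Q')
    (hM : ∀ k r, p (M k r) = ι (δ k r)) (hΔ : ∀ r, q (Δ r) = SymProd.mk fun k => δ k r) :
    IsProductLift G p q ι x₀ e₀ p₀ z' Q' := by
  obtain ⟨g, η, L, Γ, hL, hΓ⟩ := hQ
  refine ⟨g, fun k => (η k).trans (δ k), fun k => (L k).trans (M k), Γ.trans Δ, ?_, ?_⟩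
  · intro k r
    simp only [Path.trans_apply]
    split_ifs
    exacts [hL _ _, hM _ _]
  · intro r
    simp only [Path.trans_apply]
    split_ifs
    exacts [hΓ _, hΔ _]

/-- Two choices of the paths differ by loops at `x₀`, and these act on both covers through the same
elements of `G`. -/
theorem unique (hE : IsCoverOf p (ι x₀) φ) (hP : IsSymCoverOf q ι x₀ φ)
    {z : Fin n → F × E} {Q Q' : P} (hQ : IsProductLift G p q ι x₀ e₀ p₀ z Q)
    (hQ' : IsProductLift G p q ι x₀ e₀ p₀ z Q') : Q = Q' := by
  have hqq : q Q' = q Q := by rw [hQ.apply_eq, hQ'.apply_eq]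
  obtain ⟨c, rfl⟩ := hP.isQuotientCoveringMap.apply_eq_iff_mem_orbit.1 hqq
  obtain ⟨g, η, L, Γ, hL, hΓ⟩ := hQ
  obtain ⟨g', η', L', Γ', hL', hΓ'⟩ := hQ'
  have := hE.isQuotientCoveringMap.isCancelSMul
  have := hP.isQuotientCoveringMap.isCancelSMul
  have cP := hP.isQuotientCoveringMap.continuous_const_smul
  let γ : Fin n → Path x₀ x₀ := fun k => (η k).trans (η' k).symm
  have h1 : ∀ k, φ (FundamentalGroup.fromPath
      (Path.Homotopic.Quotient.mk ((γ k).map ι.continuous))) = g' k * (g k)⁻¹ := by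
    intro k
    have h : ((L k).trans (L' k).symm) 1 = _ • ((L k).trans (L' k).symm) 0 :=
      hE.monodromy ((γ k).map ι.continuous) ((L k).trans (L' k).symm).toContinuousMap (fun r => by
        change p (((L k).trans (L' k).symm) r) = ι (((η k).trans (η' k).symm) r)
        simp only [Path.trans_apply, Path.symm_apply]
        split_ifs
        exacts [hL _ _, hL' _ _])
    rw [Path.target, Path.source, ← mul_smul] at h
    rw [eq_mul_inv_iff_mul_eq]
    exact (IsCancelSMul.right_cancel _ _ e₀ h).symm
  -- The endpoints `Q` and `c • Q` must be made to agree before the two lifts form a loop.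
  let Γ'' : Path (c⁻¹ • (∏ k, g' k) • p₀) Q :=
    (Γ'.map (cP c⁻¹)).cast rfl (by simp)
  have h2 : (Γ.trans Γ''.symm) 1 = _ • (Γ.trans Γ''.symm) 0 :=
    hP.monodromy γ (Γ.trans Γ''.symm).toContinuousMap (fun r => by
      change q ((Γ.trans Γ''.symm) r) = SymProd.mk fun k => ((η k).trans (η' k).symm) r
      simp only [Path.trans_apply, Path.symm_apply]
      split_ifs
      · exact hΓ _
      · simpa [Γ'', hP.isQuotientCoveringMap.map_smul] using hΓ' _)
  simp only [h1] at h2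
  rw [Path.target, Path.source, ← mul_smul, ← mul_smul, Finset.prod_mul_distrib,
    Finset.prod_inv_distrib] at h2
  have h3 := IsCancelSMul.right_cancel _ _ p₀ h2
  have : c = 1 := by simpa using h3
  simp [this]

end IsProductLift

/-- Taking products of points of `ι^* E` is continuous. -/
theorem continuous_of_isProductLift [LocallyPathConnectedSpace F] (hE : IsCoverOf p (ι x₀) φ)
    (hP : IsSymCoverOf q ι x₀ φ) {X : Type*} [TopologicalSpace X] (z : X → Fin n → F × E)
    (hz : Continuous z) (hpz : ∀ x k, p (z x k).2 = ι (z x k).1) (Θ : X → P)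
    (hΘ : ∀ x, IsProductLift G p q ι x₀ e₀ p₀ (z x) (Θ x)) : Continuous Θ := by
  rw [continuous_iff_continuousAt]
  intro x
  have lE := hE.isQuotientCoveringMap.isCoveringMap.isLocalHomeomorph
  have lP := hP.isQuotientCoveringMap.isCoveringMap.isLocalHomeomorph
  obtain ⟨e, he, hqe⟩ := lP (Θ x)
  choose d hd hpd using fun k => lE (z x k).2
  have hq : ∀ y, q (Θ y) = SymProd.mk fun k => (z y k).1 := fun y => (hΘ y).apply_eq
  have cy : Continuous fun x => SymProd.mk fun k => (z x k).1 :=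
    continuous_symProd_mk.comp (by fun_prop)
  have hW : SymProd.mk ⁻¹' e.target ∈ 𝓝 (fun k => (z x k).1) := by
    refine (e.open_target.preimage continuous_symProd_mk).mem_nhds ?_
    rw [Set.mem_preimage, ← hq, hqe]
    exact e.map_source he
  rw [nhds_pi, Filter.mem_pi] at hW
  obtain ⟨I, -, V, hV, hVW⟩ := hW
  have hU : ∀ k, ∃ U ∈ 𝓝 (z x k).1, IsPathConnected U ∧ U ⊆ V k ∩ ι ⁻¹' (d k).target := by
    intro k
    have : V k ∩ ι ⁻¹' (d k).target ∈ 𝓝 (z x k).1 := by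
      refine Filter.inter_mem (hV k) (((d k).open_target.preimage ι.continuous).mem_nhds ?_)
      rw [Set.mem_preimage, ← hpz, hpd]
      exact (d k).map_source (hd k)
    obtain ⟨U, ⟨hU, hU'⟩, hUV⟩ :=
      (LocallyPathConnectedSpace.path_connected_basis (z x k).1).mem_iff.1 this
    exact ⟨U, hU, hU', hUV⟩
  choose U hU hUp hUV using hU
  have key : ∀ᶠ x' in 𝓝 x, Θ x' = e.symm (SymProd.mk fun k => (z x' k).1) := by
    have h1 : ∀ᶠ x' in 𝓝 x, ∀ k, (z x' k).1 ∈ U k := by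
      rw [Filter.eventually_all]
      exact fun k => (show Continuous fun x => (z x k).1 by fun_prop).continuousAt.eventually (hU k)
    have h2 : ∀ᶠ x' in 𝓝 x, ∀ k, (z x' k).2 ∈ (d k).source := by
      rw [Filter.eventually_all]
      exact fun k => (show Continuous fun x => (z x k).2 by fun_prop).continuousAt.eventually
        ((d k).open_source.mem_nhds (hd k))
    filter_upwards [h1, h2] with x' h1 h2
    have hJ : ∀ k, JoinedIn (U k) (z x k).1 (z x' k).1 := fun k =>
      (hUp k).joinedIn _ (mem_of_mem_nhds (hU k)) _ (h1 k)
    choose δ hδ using hJ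
    have hδd : ∀ k r, ι (δ k r) ∈ (d k).target := fun k r => (hUV k (hδ k r)).2
    have hδe : ∀ r, (SymProd.mk fun k => δ k r) ∈ e.target := fun r =>
      hVW fun k _ => (hUV k (hδ k r)).1
    have hend : ∀ (x' : X) (k), (z x' k).2 ∈ (d k).source →
        (z x' k).2 = (d k).symm (ι (z x' k).1) := fun x' k h => by
      rw [← hpz, hpd, (d k).left_inv h]
    let M : ∀ k, Path (z x k).2 (z x' k).2 := fun k =>
      { toFun := fun r => (d k).symm (ι (δ k r))
        continuous_toFun := (d k).continuousOn_symm.comp_continuous (by fun_prop) (hδd k)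
        source' := by simp [hend x k (hd k)]
        target' := by simp [hend x' k (h2 k)] }
    let Δ : Path (Θ x) (e.symm (SymProd.mk fun k => (z x' k).1)) :=
      { toFun := fun r => e.symm (SymProd.mk fun k => δ k r)
        continuous_toFun := e.continuousOn_symm.comp_continuous
          (continuous_symProd_mk.comp (by fun_prop)) hδe
        source' := by simp [← hq, hqe, e.left_inv he]
        target' := by simp }
    refine (hΘ x').unique hE hP ((hΘ x).trans δ M Δ ?_ ?_)
    · intro k r
      change p ((d k).symm (ι (δ k r))) = _
      rw [hpd, (d k).right_inv (hδd k r)]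
    · intro r
      change q (e.symm _) = _
      rw [hqe, e.right_inv (hδe r)]
  refine ContinuousAt.congr ?_ (key.mono fun _ h => h.symm)
  refine ContinuousAt.comp (f := fun x => SymProd.mk fun k => (z x k).1) ?_ cy.continuousAt
  refine e.continuousAt_symm ?_
  rw [← hq, hqe]
  exact e.map_source he

end ProductLift

/-! ### The degree of a circle map -/

/-- The total variation of a step function is the sum of its jumps. -/
theorem sub_eq_sum_of_jumps {a b : ℝ} (hab : a ≤ b) (s : ℝ → ℤ) (K : Finset ℝ) :
    ∀ N : ℝ → ℤ, (∀ r ∈ K, r ∈ Set.Ioo a b) →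
      (∀ r ∈ Set.Icc a b, r ∉ K → ∀ᶠ r' in 𝓝 r, N r' = N r) →
      (∀ r ∈ K, ∃ m : ℤ, (∀ᶠ r' in 𝓝[<] r, N r' = m) ∧ ∀ᶠ r' in 𝓝[>] r, N r' = m + s r) →
      N b - N a = ∑ r ∈ K, s r := by
  induction K using Finset.induction_on with
  | empty =>
    intro N _ h _
    have hc : ContinuousOn N (Set.Icc a b) := fun r hr =>
      ContinuousAt.continuousWithinAt (tendsto_nhds_of_eventually_eq (h r hr (by simp)))
    simp [isPreconnected_Icc.constant hc (Set.left_mem_Icc.2 hab) (Set.right_mem_Icc.2 hab)]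
  | insert r₀ K hr₀ ih =>
    intro N hK h hj
    obtain ⟨m, hm, hm'⟩ := hj r₀ (by simp)
    have h₀ := hK r₀ (by simp)
    -- Remove the jump at `r₀`.
    let N' : ℝ → ℤ := fun r => if r < r₀ then N r else if r = r₀ then m else N r - s r₀
    have hlt : ∀ r < r₀, ∀ᶠ r' in 𝓝 r, N' r' = N r' := fun r hr => by
      filter_upwards [gt_mem_nhds hr] with r' hr'
      simp [N', hr']
    have hgt : ∀ r, r₀ < r → ∀ᶠ r' in 𝓝 r, N' r' = N r' - s r₀ := fun r hr => by
      filter_upwards [lt_mem_nhds hr] with r' hr'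
      simp [N', hr'.not_gt, hr'.ne']
    have key := ih N' (fun r hr => hK r (by simp [hr])) ?_ ?_
    · have hb : N' b = N b - s r₀ := (hgt b h₀.2).self_of_nhds
      have ha : N' a = N a := (hlt a h₀.1).self_of_nhds
      rw [Finset.sum_insert hr₀, ← key, ha, hb]
      ring
    · intro r hr hrK
      rcases lt_trichotomy r r₀ with hr' | rfl | hr'
      · filter_upwards [hlt r hr', h r hr (by simp [hrK, hr'.ne])] with r' h1 h2
        rw [h1, h2, (hlt r hr').self_of_nhds]
      · rw [nhds_eq_nhdsWithin_sup_nhdsWithin r (I₁ := Set.Iio r) (I₂ := Set.Ici r) (by simp),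
          Filter.eventually_sup,
          ← Set.Ioi_insert, nhdsWithin_insert, Filter.eventually_sup]
        refine ⟨?_, by simp, ?_⟩
        · filter_upwards [hm, self_mem_nhdsWithin] with r' h1 h2
          simp [N', h1, show r' < r from h2]
        · filter_upwards [hm', self_mem_nhdsWithin] with r' h1 h2
          simp [N', h1, (show r < r' from h2).not_gt, (show r < r' from h2).ne']
      · filter_upwards [hgt r hr', h r hr (by simp [hrK, hr'.ne'])] with r' h1 h2
        rw [h1, h2, (hgt r hr').self_of_nhds]
    · intro r hr
      obtain ⟨m', h1, h2⟩ := hj r (by simp [hr])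
      rcases lt_or_gt_of_ne (show r ≠ r₀ by rintro rfl; exact hr₀ hr) with hr' | hr'
      · refine ⟨m', ?_, ?_⟩
        · filter_upwards [h1, (hlt r hr').filter_mono nhdsWithin_le_nhds] with r' h3 h4
          rw [h4, h3]
        · filter_upwards [h2, (hlt r hr').filter_mono nhdsWithin_le_nhds] with r' h3 h4
          rw [h4, h3]
      · refine ⟨m' - s r₀, ?_, ?_⟩
        · filter_upwards [h1, (hgt r hr').filter_mono nhdsWithin_le_nhds] with r' h3 h4
          rw [h4, h3]
        · filter_upwards [h2, (hgt r hr').filter_mono nhdsWithin_le_nhds] with r' h3 h4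
          rw [h4, h3]
          ring

theorem eventually_floor_eq {Ψ : ℝ → ℝ} {r : ℝ} (hΨ : ContinuousAt Ψ r)
    (h : ∀ m : ℤ, Ψ r ≠ m) : ∀ᶠ r' in 𝓝 r, ⌊Ψ r'⌋ = ⌊Ψ r⌋ := by
  have h1 : (⌊Ψ r⌋ : ℝ) < Ψ r := lt_of_le_of_ne (Int.floor_le _) (h _).symm
  filter_upwards [hΨ.eventually (lt_mem_nhds h1),
    hΨ.eventually (gt_mem_nhds (Int.lt_floor_add_one (Ψ r)))] with r' h2 h3
  exact Int.floor_eq_iff.2 ⟨h2.le, h3⟩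

/-- The floor of a function jumps by the sign of the derivative where an integer is crossed. -/
theorem exists_floor_jump {Ψ : ℝ → ℝ} {r c : ℝ} {m : ℤ} (hΨ : HasDerivAt Ψ c r) (hc : c ≠ 0)
    (hm : Ψ r = m) : ∃ m' : ℤ, (∀ᶠ r' in 𝓝[<] r, ⌊Ψ r'⌋ = m') ∧
      ∀ᶠ r' in 𝓝[>] r, ⌊Ψ r'⌋ = m' + (SignType.sign c : ℤ) := by
  have hlt : ∀ᶠ r' in 𝓝 r, Ψ r' < m + 1 := by
    refine hΨ.continuousAt.eventually (gt_mem_nhds ?_)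
    rw [hm]; linarith
  have hgt : ∀ᶠ r' in 𝓝 r, (m : ℝ) - 1 < Ψ r' := by
    refine hΨ.continuousAt.eventually (lt_mem_nhds ?_)
    rw [hm]; linarith
  have hs := hasDerivAt_iff_tendsto_slope.1 hΨ
  have hl : 𝓝[<] r ≤ 𝓝[≠] r := nhdsWithin_mono _ fun x hx => ne_of_lt hx
  have hr : 𝓝[>] r ≤ 𝓝[≠] r := nhdsWithin_mono _ fun x hx => ne_of_gt hx
  have up : ∀ r', (m : ℝ) < Ψ r' → Ψ r' < m + 1 → ⌊Ψ r'⌋ = m := fun r' h h' =>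
    Int.floor_eq_iff.2 ⟨h.le, h'⟩
  have down : ∀ r', Ψ r' < m → (m : ℝ) - 1 < Ψ r' → ⌊Ψ r'⌋ = m - 1 := fun r' h h' =>
    Int.floor_eq_iff.2 ⟨by push_cast; linarith, by push_cast; linarith⟩
  rcases lt_or_gt_of_ne hc with hc | hc
  · have h := hs.eventually (gt_mem_nhds hc)
    refine ⟨m, ?_, ?_⟩
    · filter_upwards [hl h, hlt.filter_mono nhdsWithin_le_nhds, self_mem_nhdsWithin]
        with r' h1 h2 h3
      have h3 : r' - r < 0 := sub_neg.2 h3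
      refine up r' ?_ h2
      rw [slope_def_field, div_neg_iff, hm] at h1
      rcases h1 with h1 | h1 <;> linarith [h1.1, h1.2]
    · filter_upwards [hr h, hgt.filter_mono nhdsWithin_le_nhds, self_mem_nhdsWithin]
        with r' h1 h2 h3
      have h3 : 0 < r' - r := sub_pos.2 h3
      rw [sign_neg hc, down r' ?_ h2]
      · simp [sub_eq_add_neg]
      rw [slope_def_field, div_neg_iff, hm] at h1
      rcases h1 with h1 | h1 <;> linarith [h1.1, h1.2]
  · have h := hs.eventually (lt_mem_nhds hc)
    refine ⟨m - 1, ?_, ?_⟩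
    · filter_upwards [hl h, hgt.filter_mono nhdsWithin_le_nhds, self_mem_nhdsWithin]
        with r' h1 h2 h3
      have h3 : r' - r < 0 := sub_neg.2 h3
      refine down r' ?_ h2
      rw [slope_def_field, div_pos_iff, hm] at h1
      rcases h1 with h1 | h1 <;> linarith [h1.1, h1.2]
    · filter_upwards [hr h, hlt.filter_mono nhdsWithin_le_nhds, self_mem_nhdsWithin]
        with r' h1 h2 h3
      have h3 : 0 < r' - r := sub_pos.2 h3
      rw [sign_pos hc, up r' ?_ h2]
      · simp
      rw [slope_def_field, div_pos_iff, hm] at h1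
      rcases h1 with h1 | h1 <;> linarith [h1.1, h1.2]

theorem unitAddCircle_coe_eq_coe_iff {x y : ℝ} :
    (x : UnitAddCircle) = (y : UnitAddCircle) ↔ ∃ m : ℤ, x = y + m := by
  rw [← sub_eq_zero, ← AddCircle.coe_sub, AddCircle.coe_eq_zero_iff]
  constructor
  · rintro ⟨m, hm⟩
    exact ⟨m, by simp at hm; linarith⟩
  · rintro ⟨m, hm⟩
    exact ⟨m, by simp; linarith⟩

/-- A real function with integer values that tends to `0` vanishes near the limit point. -/
theorem eventually_eq_zero_of_forall_int {u : ℝ → ℝ} {r : ℝ} (hu : ContinuousAt u r) (h0 : u r = 0)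
    (h : ∀ᶠ r' in 𝓝 r, ∃ m : ℤ, u r' = m) : ∀ᶠ r' in 𝓝 r, u r' = 0 := by
  have h1 : ∀ᶠ r' in 𝓝 r, |u r'| < 1 := hu.abs.eventually (gt_mem_nhds (by simp [h0]))
  filter_upwards [h, h1] with r' ⟨m, hm⟩ h1
  rw [hm] at h1 ⊢
  have : |m| < 1 := by exact_mod_cast h1
  simp [Int.abs_lt_one_iff.1 this]

/-- A lift of a map of the circle advances by the same amount over each period. -/
theorem lift_add_one {f : UnitAddCircle → UnitAddCircle} {Φ : ℝ → ℝ} (hΦ : Continuous Φ)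
    (h : ∀ r : ℝ, (Φ r : UnitAddCircle) = f r) {d : ℤ} (hd : Φ 1 = Φ 0 + d) (r : ℝ) :
    Φ (r + 1) = Φ r + d := by
  have hm : ∀ r, ∃ m : ℤ, Φ (r + 1) = Φ r + m := fun r => by
    rw [← unitAddCircle_coe_eq_coe_iff, h, h]
    congr 1
    exact AddCircle.coe_add_period 1 r
  choose m hm using hm
  have hc : IsLocallyConstant m := by
    rw [IsLocallyConstant.iff_eventually_eq]
    intro r
    have := eventually_eq_zero_of_forall_int (u := fun r' => (m r' : ℝ) - m r) (r := r) (by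
      have : (fun r' => (m r' : ℝ) - m r) = fun r' => Φ (r' + 1) - Φ r' - m r := by
        funext r'; rw [hm]; ring
      rw [this]
      fun_prop) (by simp) (.of_forall fun r' => ⟨m r' - m r, by push_cast; rfl⟩)
    filter_upwards [this] with r' h
    exact_mod_cast sub_eq_zero.1 h
  have h0 := hm 0
  rw [zero_add, hd, hc.apply_eq_of_preconnectedSpace 0 r] at h0
  rw [hm, add_left_cancel h0]

theorem exists_circle_lift {f : UnitAddCircle → UnitAddCircle} (hf : Continuous f) :
    ∃ d : ℤ, ∃ Φ : ℝ → ℝ, Continuous Φ ∧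
      (∀ r : ℝ, ((Φ r : ℝ) : UnitAddCircle) = f (r : UnitAddCircle)) ∧ Φ 1 = Φ 0 + d := by
  obtain ⟨x, hx⟩ := QuotientAddGroup.mk_surjective (f (0 : ℝ))
  obtain ⟨Φ, ⟨-, h⟩, -⟩ := (AddCircle.isCoveringMap_coe (1 : ℝ)).existsUnique_continuousMap_lifts
    (f := ⟨fun r : ℝ => f (r : UnitAddCircle), hf.comp (AddCircle.continuous_mk' _)⟩)
    (a₀ := 0) (e₀ := x) hx
  have h' : ∀ r, (Φ r : UnitAddCircle) = f r := fun r => congrFun h r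
  have : ((Φ 1 : ℝ) : UnitAddCircle) = (Φ 0 : ℝ) := by
    rw [h', h']
    congr 1
    simp
  obtain ⟨d, hd⟩ := unitAddCircle_coe_eq_coe_iff.1 this
  exact ⟨d, Φ, Φ.continuous, h', hd⟩

/-- The degree of a map of the circle is the signed number of preimages of a regular value. The
regular value is `1/2`, and the map is given near its preimages by `(τ + 1) / 2`. -/
theorem circleDegree_eq_sum {f : UnitAddCircle → UnitAddCircle} (hf : Continuous f)
    (Z : Finset UnitAddCircle) (hZ : ∀ θ, θ ∈ Z ↔ f θ = ((1 / 2 : ℝ) : UnitAddCircle))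
    (s : UnitAddCircle → ℤ)
    (hs : ∀ θ ∈ Z, ∃ (τ : ℝ → ℝ) (c : ℝ), τ 0 = 0 ∧ HasDerivAt τ c 0 ∧
      c ≠ 0 ∧ s θ = SignType.sign c ∧
      ∀ᶠ r : ℝ in 𝓝 0, f (θ + (r : UnitAddCircle)) = (((τ r + 1) / 2 : ℝ) : UnitAddCircle)) :
    circleDegree f = ∑ θ ∈ Z, s θ := by
  obtain ⟨Φ, hΦ, hΦf, hd⟩ := Classical.epsilon_spec (exists_circle_lift hf)
  change Φ 1 = Φ 0 + circleDegree f at hd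
  have : Infinite (Set.Ico (0 : ℝ) (0 + 1)) := (Set.Ico_infinite (by norm_num)).to_subtype
  have : Infinite UnitAddCircle :=
    Infinite.of_injective _ (AddCircle.equivIco (1 : ℝ) 0).symm.injective
  -- Count over one period that starts off the preimages.
  obtain ⟨θ₀, hθ₀⟩ := Infinite.exists_notMem_finset Z
  obtain ⟨a, rfl⟩ := QuotientAddGroup.mk_surjective θ₀
  have haZ : (a : UnitAddCircle) ∉ Z := hθ₀
  let Ψ : ℝ → ℝ := fun r => Φ r - 1 / 2
  have hΨ : Continuous Ψ := by fun_prop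
  have hΨZ : ∀ r : ℝ, (r : UnitAddCircle) ∈ Z ↔ ∃ m : ℤ, Ψ r = m := fun r => by
    rw [hZ, ← hΦf, unitAddCircle_coe_eq_coe_iff]
    exact exists_congr fun m => by simp only [Ψ]; constructor <;> intro h <;> linarith
  have hjump : ∀ r : ℝ, (r : UnitAddCircle) ∈ Z → ∃ m : ℤ, (∀ᶠ r' in 𝓝[<] r, ⌊Ψ r'⌋ = m) ∧
      ∀ᶠ r' in 𝓝[>] r, ⌊Ψ r'⌋ = m + s r := by
    intro r hr
    obtain ⟨τ₀, c, hτ₀, hc₀, hc0, hsc, hfτ₀⟩ := hs r hr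
    obtain ⟨τ, hτ, hc, hfτ⟩ : ∃ τ : ℝ → ℝ, τ r = 0 ∧ HasDerivAt τ c r ∧
        ∀ᶠ r' : ℝ in 𝓝 r, f r' = (((τ r' + 1) / 2 : ℝ) : UnitAddCircle) := by
      refine ⟨fun r' => τ₀ (r' - r), by simpa using hτ₀, ?_, ?_⟩
      · exact HasDerivAt.comp_sub_const r r (by simpa using hc₀)
      · have : Filter.Tendsto (fun r' => r' - r) (𝓝 r) (𝓝 0) := by
          simpa using (continuous_sub_right r).tendsto r
        filter_upwards [this.eventually hfτ₀] with r' h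
        rw [← h, AddCircle.coe_sub, add_sub_cancel]
    obtain ⟨m, hm⟩ := (hΨZ r).1 hr
    -- The lift is determined by `τ` near `r`, as both sides lift the same map.
    have h0 : ∀ᶠ r' in 𝓝 r, Ψ r' - m - τ r' / 2 = 0 := by
      refine eventually_eq_zero_of_forall_int ?_ (by rw [hm, hτ]; ring) ?_
      · exact (hΨ.continuousAt.sub continuousAt_const).sub (hc.continuousAt.div_const 2)
      · filter_upwards [hfτ] with r' h
        rw [← hΦf, unitAddCircle_coe_eq_coe_iff] at h
        obtain ⟨k, hk⟩ := h
        refine ⟨k - m, ?_⟩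
        simp only [Ψ]
        push_cast
        linarith
    have hder : HasDerivAt Ψ (c / 2) r := by
      refine ((hc.div_const 2).const_add (m : ℝ)).congr_of_eventuallyEq ?_
      filter_upwards [h0] with r' h
      linarith
    obtain ⟨m', h1, h2⟩ := exists_floor_jump hder (by simpa using hc0) hm
    refine ⟨m', h1, ?_⟩
    rwa [hsc, show SignType.sign c = SignType.sign (c / 2) by
      rcases lt_or_gt_of_ne hc0 with h | h
      · rw [sign_neg h, sign_neg (by linarith)]
      · rw [sign_pos h, sign_pos (by linarith)]]
  have : Fact ((0 : ℝ) < 1) := ⟨one_pos⟩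
  let e := AddCircle.equivIco (1 : ℝ) a
  have hecoe : ∀ θ : UnitAddCircle, ((e θ : ℝ) : UnitAddCircle) = θ := fun θ =>
    e.symm_apply_apply θ
  let K : Finset ℝ := Z.image fun θ => (e θ : ℝ)
  have hK : ∀ r ∈ Set.Icc a (a + 1), r ∉ K → (r : UnitAddCircle) ∉ Z := by
    intro r hr hrK hrZ
    rcases eq_or_lt_of_le hr.2 with rfl | h
    · exact haZ (by simpa using hrZ)
    · refine hrK (Finset.mem_image.2 ⟨r, hrZ, ?_⟩)
      exact congrArg Subtype.val (e.apply_symm_apply ⟨r, hr.1, h⟩)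
  have key := sub_eq_sum_of_jumps (by linarith : a ≤ a + 1) (fun r => s r) K (fun r => ⌊Ψ r⌋)
    (by
      intro r hr
      obtain ⟨θ, hθ, rfl⟩ := Finset.mem_image.1 hr
      refine ⟨lt_of_le_of_ne (e θ).2.1 ?_, (e θ).2.2⟩
      intro h
      refine haZ ?_
      rw [h, hecoe]
      exact hθ)
    (by
      intro r hr hrK
      exact eventually_floor_eq hΨ.continuousAt fun m hm => hK r hr hrK ((hΨZ r).2 ⟨m, hm⟩))
    (by
      intro r hr
      obtain ⟨θ, hθ, rfl⟩ := Finset.mem_image.1 hr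
      exact hjump _ (by rwa [hecoe]))
  have h1 : Ψ (a + 1) = Ψ a + circleDegree f := by
    simp only [Ψ, lift_add_one hΦ hΦf hd]
    ring
  rw [h1, Int.floor_add_intCast, add_sub_cancel_left, Finset.sum_image] at key
  · simpa [hecoe] using key
  · intro x _ y _ h
    exact e.injective (Subtype.ext h)

/-! ### Attaching circles and collars -/

theorem continuous_discBoundary : Continuous discBoundary :=
  (continuous_subtype_val.comp AddCircle.continuous_toCircle).subtype_mk _

theorem injective_discBoundary : Function.Injective discBoundary := fun a b h => by
  have h' : ((discBoundary a : Disc) : ℂ) = (discBoundary b : Disc) := congrArg Subtype.val h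
  exact AddCircle.injective_toCircle one_ne_zero (Circle.ext h')

theorem exists_discBoundary_eq {x : Disc} (hx : ‖(x : ℂ)‖ = 1) : ∃ θ, discBoundary θ = x := by
  refine ⟨((x : ℂ).arg / (2 * Real.pi) : ℝ), Subtype.ext ?_⟩
  change ((AddCircle.toCircle _ : Circle) : ℂ) = x
  rw [AddCircle.toCircle_apply_mk, Circle.coe_exp,
    show 2 * Real.pi / 1 * ((x : ℂ).arg / (2 * Real.pi)) = (x : ℂ).arg by
      field_simp]
  simpa [hx] using Complex.norm_mul_exp_arg_mul_I (x : ℂ)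

/-- A neighbourhood of a point of the circle is the image of a neighbourhood of `0` in `ℝ`. -/
theorem map_nhds_zero_circle (θ : UnitAddCircle) :
    Filter.map (fun r : ℝ => θ + (r : UnitAddCircle)) (𝓝 0) = 𝓝 θ := by
  have h := (AddCircle.isCoveringMap_coe (1 : ℝ)).isLocalHomeomorph.map_nhds_eq 0
  change Filter.map ((fun x => θ + x) ∘ ((↑) : ℝ → UnitAddCircle)) (𝓝 0) = 𝓝 θ
  rw [← Filter.map_map, h]
  simpa only [Homeomorph.coe_addLeft, add_zero, QuotientAddGroup.mk_zero] using
    (Homeomorph.addLeft θ).map_nhds_eq 0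

theorem cross_smul_add_smul_left (a b : ℝ) (v w : EuclideanSpace ℝ (Fin 2)) :
    cross (a • v + b • w) v = b * cross w v := by
  simp [cross]
  ring

section LocalCoordinates

variable {F : Type*} [TopologicalSpace F] [ChartedSpace (EuclideanSpace ℝ (Fin 2)) F]
  {V : Type*} [NormedAddCommGroup V] [NormedSpace ℝ V]

theorem hasFDerivAt_extChartAt_comp {f : V → F} {v : V} {D : V →L[ℝ] EuclideanSpace ℝ (Fin 2)}
    (hf : HasMFDerivAt 𝓘(ℝ, V) (𝓡 2) f v D) :
    HasFDerivAt (fun x => extChartAt (𝓡 2) (f v) (f x)) D v := by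
  have h : HasFDerivWithinAt (fun x => extChartAt (𝓡 2) (f v) (f x)) D (Set.range id) v := hf.2
  rwa [Set.range_id, hasFDerivWithinAt_univ] at h

/-- A curve on a surface expressed in a smooth parametrisation `κ` with invertible derivative. -/
theorem exists_local_coordinates [IsManifold (𝓡 2) ∞ F] {κ : ℝ × ℝ → F} {z₀ : ℝ × ℝ}
    (hκ : ContMDiffAt 𝓘(ℝ, ℝ × ℝ) (𝓡 2) ∞ κ z₀)
    {D : ℝ × ℝ →L[ℝ] EuclideanSpace ℝ (Fin 2)} (hκD : HasMFDerivAt 𝓘(ℝ, ℝ × ℝ) (𝓡 2) κ z₀ D)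
    (hc : 0 < cross (D (0, 1)) (D (1, 0))) {γ : ℝ → F} {C : ℝ →L[ℝ] EuclideanSpace ℝ (Fin 2)}
    (hγ : HasMFDerivAt 𝓘(ℝ, ℝ) (𝓡 2) γ 0 C) (h0 : γ 0 = κ z₀) :
    ∃ (w : ℝ → ℝ × ℝ) (w' : ℝ × ℝ), w 0 = z₀ ∧ HasDerivAt w w' 0 ∧
      (∀ᶠ r in 𝓝 0, κ (w r) = γ r) ∧
      SignType.sign w'.2 = SignType.sign (cross (C 1) (D (1, 0))) := by
  let ch := extChartAt (𝓡 2) (κ z₀)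
  have hD (a b : ℝ) : D (a, b) = a • D (1, 0) + b • D (0, 1) := by
    rw [← map_smul, ← map_smul, ← map_add]
    simp
  have hderiv : HasFDerivAt (fun z => ch (κ z)) D z₀ := hasFDerivAt_extChartAt_comp hκD
  have hcd : ContDiffAt ℝ ∞ (fun z => ch (κ z)) z₀ := by
    have h : ContDiffWithinAt ℝ ∞ (fun z => ch (κ z)) (Set.range id) z₀ :=
      (contMDiffAt_iff.1 hκ).2
    rwa [Set.range_id, contDiffWithinAt_univ] at h
  have hinj : Function.Injective D := by
    refine (injective_iff_map_eq_zero D).2 fun x hx => ?_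
    obtain ⟨a, b⟩ := x
    rw [hD] at hx
    have hb : b = 0 := by
      have := cross_smul_add_smul_left a b (D (1, 0)) (D (0, 1))
      rw [hx] at this
      have h2 : b * cross (D (0, 1)) (D (1, 0)) = 0 := by rw [← this]; simp [cross]
      exact (mul_eq_zero.1 h2).resolve_right hc.ne'
    have ha : a = 0 := by
      subst hb
      rw [zero_smul, add_zero] at hx
      refine (smul_eq_zero.1 hx).resolve_right fun h => ?_
      rw [h] at hc
      simp [cross] at hc
    simp [ha, hb]
  let D' : (ℝ × ℝ) ≃L[ℝ] EuclideanSpace ℝ (Fin 2) :=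
    (LinearEquiv.ofInjectiveOfFinrankEq D.toLinearMap hinj (by simp)).toContinuousLinearEquiv
  have hD' : (D' : ℝ × ℝ →L[ℝ] EuclideanSpace ℝ (Fin 2)) = D := by
    ext x <;> rfl
  have hs : HasStrictFDerivAt (fun z => ch (κ z))
      (D' : ℝ × ℝ →L[ℝ] EuclideanSpace ℝ (Fin 2)) z₀ := by
    rw [hD', ← hderiv.fderiv]
    exact hcd.hasStrictFDerivAt (by simp)
  have hγd : HasDerivAt (fun r => ch (γ r)) (C 1) 0 := by
    have h := (hasFDerivAt_extChartAt_comp hγ).hasDerivAt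
    rw [h0] at h
    exact h
  have hγ0 : ch (γ 0) = ch (κ z₀) := by rw [h0]
  let g := hs.localInverse
  have hg0 : g (ch (γ 0)) = z₀ := by rw [hγ0]; exact hs.localInverse_apply_image
  have hgd : HasFDerivAt g (D'.symm : EuclideanSpace ℝ (Fin 2) →L[ℝ] ℝ × ℝ) (ch (γ 0)) := by
    rw [hγ0]
    exact hs.to_localInverse.hasFDerivAt
  have hw : HasDerivAt (fun r => g (ch (γ r))) (D'.symm (C 1)) 0 :=
    HasFDerivAt.comp_hasDerivAt (f := fun r => ch (γ r)) (0 : ℝ) hgd hγd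
  refine ⟨fun r => g (ch (γ r)), D'.symm (C 1), hg0, hw, ?_, ?_⟩
  · have h1 : ∀ᶠ r in 𝓝 (0 : ℝ), ch (κ (g (ch (γ r)))) = ch (γ r) := by
      have := hs.eventually_right_inverse
      rw [← hγ0] at this
      exact hγd.continuousAt.eventually this
    have h2 : ∀ᶠ r in 𝓝 (0 : ℝ), γ r ∈ ch.source :=
      hγ.continuousAt.eventually (by rw [h0]; exact extChartAt_source_mem_nhds (I := 𝓡 2) (κ z₀))
    have h3 : ∀ᶠ r in 𝓝 (0 : ℝ), κ (g (ch (γ r))) ∈ ch.source := by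
      have hκc : ContinuousAt κ (g (ch (γ 0))) := by rw [hg0]; exact hκ.continuousAt
      refine (hκc.comp (f := fun r => g (ch (γ r))) hw.continuousAt).eventually ?_
      simp only [Function.comp, hg0]
      exact extChartAt_source_mem_nhds (I := 𝓡 2) (κ z₀)
    filter_upwards [h1, h2, h3] with r h1 h2 h3
    exact ch.injOn h3 h2 h1
  · have h1 : D (D'.symm (C 1)) = C 1 := by
      rw [← hD']
      exact D'.apply_symm_apply _
    change SignType.sign (D'.symm (C 1)).2 = SignType.sign (cross (C 1) (D (1, 0)))
    generalize D'.symm (C 1) = x at h1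
    obtain ⟨a, b⟩ := x
    rw [← h1, hD, cross_smul_add_smul_left, sign_mul, sign_pos hc, mul_one]

end LocalCoordinates

namespace Handlebody

variable {F Y : Type*} [TopologicalSpace F] [TopologicalSpace Y]
  [ChartedSpace (EuclideanSpace ℝ (Fin 2)) F] {ι : C(F, Y)} {g : ℕ}

/-- The annulus around the `k`-th attaching circle, in real coordinates. -/
def annulus (U : Handlebody ι g) (k : Fin g) (z : ℝ × ℝ) : F :=
  U.collar k (z.1 : UnitAddCircle) z.2

theorem contMDiffAt_annulus (U : Handlebody ι g) (k : Fin g) {z : ℝ × ℝ}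
    (hz : z.2 ∈ Set.Ioo (-1 : ℝ) 1) :
    ContMDiffAt 𝓘(ℝ, ℝ × ℝ) (𝓡 2) ∞ (U.annulus k) z :=
  (U.collar_smooth k).contMDiffAt ((isOpen_univ.prod isOpen_Ioo).mem_nhds ⟨trivial, hz⟩)

theorem circle_eq_annulus (U : Handlebody ι g) (k : Fin g) (x r : ℝ) :
    U.circle k (x + r : UnitAddCircle) = U.annulus k (x + r, 0) := by
  simp [circle, annulus]

theorem hasMFDerivAt_circle (U : Handlebody ι g) (k : Fin g) (x : ℝ) :
    HasMFDerivAt 𝓘(ℝ, ℝ) (𝓡 2) (fun r : ℝ => U.circle k (x + r : UnitAddCircle)) 0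
      ((mfderiv 𝓘(ℝ, ℝ × ℝ) (𝓡 2) (U.annulus k) (x + 0, 0)).comp
        (ContinuousLinearMap.inl ℝ ℝ ℝ)) := by
  have h1 : HasFDerivAt (fun r : ℝ => (x + r, (0 : ℝ))) (ContinuousLinearMap.inl ℝ ℝ ℝ) 0 := by
    have := ((hasFDerivAt_id (𝕜 := ℝ) (0 : ℝ)).const_add x).prodMk
      (hasFDerivAt_const (𝕜 := ℝ) (0 : ℝ) (0 : ℝ))
    exact this
  have h2 := ((U.contMDiffAt_annulus k (z := (x + 0, 0)) (by simp)).mdifferentiableAt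
    (by simp)).hasMFDerivAt
  have h3 := HasMFDerivAt.comp (f := fun r : ℝ => (x + r, (0 : ℝ))) 0 h2 h1.hasMFDerivAt
  have h4 : (fun r : ℝ => U.circle k (x + r : UnitAddCircle)) =
      U.annulus k ∘ fun r : ℝ => (x + r, (0 : ℝ)) := funext fun r => U.circle_eq_annulus k x r
  rw [h4]
  exact h3

theorem velocity_circle (U : Handlebody ι g) (k : Fin g) (x : ℝ) :
    velocity (U.circle k) (x : UnitAddCircle) =
      mfderiv 𝓘(ℝ, ℝ × ℝ) (𝓡 2) (U.annulus k) (x, 0) ((1, 0) : ℝ × ℝ) := by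
  unfold velocity
  rw [(U.hasMFDerivAt_circle k x).mfderiv]
  have : (x + 0, (0 : ℝ)) = (x, 0) := by simp
  rw [this]
  rfl

theorem mdifferentiableAt_circle (U : Handlebody ι g) (k : Fin g) (θ : UnitAddCircle) :
    MDifferentiableAt 𝓘(ℝ, ℝ) (𝓡 2) (fun r : ℝ => U.circle k (θ + r : UnitAddCircle)) 0 := by
  obtain ⟨x, rfl⟩ := QuotientAddGroup.mk_surjective θ
  exact (U.hasMFDerivAt_circle k x).mdifferentiableAt

theorem map_circle (U : Handlebody ι g) (k : Fin g) (θ : UnitAddCircle) :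
    ι (U.circle k θ) = U.handle k (discBoundary θ, Core.mid) :=
  (U.handle_boundary k θ Core.mid).symm

theorem continuous_circle (U : Handlebody ι g) (hι : IsEmbedding ι) (k : Fin g) :
    Continuous (U.circle k) := by
  rw [hι.continuous_iff]
  have : ι ∘ U.circle k = fun θ => U.handle k (discBoundary θ, Core.mid) :=
    funext fun θ => U.map_circle k θ
  rw [this]
  have := continuous_discBoundary
  fun_prop

theorem handle_injective₂ (U : Handlebody ι g) {k k' : Fin g} {z z' : Disc × Core}
    (h : U.handle k z = U.handle k' z') : k = k' ∧ z = z' := by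
  have := @U.handle_injective (k, z) (k', z') h
  simpa using this

theorem collar_injective (U : Handlebody ι g) {k k' : Fin g} {θ θ' : UnitAddCircle} {t t' : Core}
    (h : U.collar k θ t = U.collar k' θ' t') : k = k' ∧ θ = θ' ∧ t = t' := by
  have h' := congrArg ι h
  rw [← U.handle_boundary, ← U.handle_boundary] at h'
  obtain ⟨h1, h2⟩ := U.handle_injective₂ h'
  rw [Prod.mk.injEq] at h2
  exact ⟨h1, injective_discBoundary h2.1, h2.2⟩

theorem circle_injective (U : Handlebody ι g) {k k' : Fin g} {θ θ' : UnitAddCircle}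
    (h : U.circle k θ = U.circle k' θ') : k = k' ∧ θ = θ' := by
  have := U.collar_injective (t := Core.mid) (t' := Core.mid) h
  exact ⟨this.1, this.2.1⟩

end Handlebody

/-! ### Crossings of the attaching circles -/

theorem signType_coe_eq_zero_iff {a : SignType} : (a : ℤ) = 0 ↔ a = 0 := by
  cases a <;> decide

namespace HeegaardSplitting

variable {F Y : Type*} [TopologicalSpace F] [TopologicalSpace Y]
  [ChartedSpace (EuclideanSpace ℝ (Fin 2)) F] {g : ℕ} (S : HeegaardSplitting F Y g)

/-- The sign of the intersection of the curves `β_k` and `α_l` at the parameters `z`. -/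
def crossingSign (k l : Fin g) (z : UnitAddCircle × UnitAddCircle) : ℤ :=
  SignType.sign (cross (velocity (S.β k) z.1) (velocity (S.α l) z.2))

/-- The parameters of the intersection points of `β_k` and `α_l`. -/
def crossings (k l : Fin g) : Set (UnitAddCircle × UnitAddCircle) :=
  {z | S.β k z.1 = S.α l z.2}

/-- Where `β_k` runs through the open annulus around `α_l`, it is described by differentiable
functions in annulus coordinates; on the core, the height has the sign of the crossing as the sign
of its derivative. -/
theorem exists_annulus_coordinates [IsManifold (𝓡 2) ∞ F] {k l : Fin g} {s : UnitAddCircle}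
    {x t : ℝ} (ht : t ∈ Set.Ioo (-1 : ℝ) 1) (h : S.β k s = S.U₀.annulus l (x, t)) :
    ∃ (w : ℝ → ℝ × ℝ) (w' : ℝ × ℝ), w 0 = (x, t) ∧ HasDerivAt w w' 0 ∧
      (∀ᶠ r : ℝ in 𝓝 0, S.β k (s + (r : UnitAddCircle)) = S.U₀.annulus l (w r) ∧
        (w r).2 ∈ Set.Ioo (-1 : ℝ) 1) ∧
      (t = 0 → (SignType.sign w'.2 : ℤ) = S.crossingSign k l (s, x)) := by
  have hκ := S.U₀.contMDiffAt_annulus l (z := (x, t)) ht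
  obtain ⟨w, w', h0, hw, he, hs⟩ := exists_local_coordinates hκ
    (hκ.mdifferentiableAt (by simp)).hasMFDerivAt (S.U₀.collar_oriented l x t ht)
    (S.U₁.mdifferentiableAt_circle k s).hasMFDerivAt
    (by simpa [HeegaardSplitting.β] using h)
  refine ⟨w, w', h0, hw, ?_, ?_⟩
  · have h1 : ∀ᶠ r in 𝓝 (0 : ℝ), (w r).2 ∈ Set.Ioo (-1 : ℝ) 1 := by
      have hc : ContinuousAt (fun r => (w r).2) 0 := continuousAt_snd.comp hw.continuousAt
      refine hc.eventually (isOpen_Ioo.mem_nhds ?_)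
      simpa only [h0] using ht
    filter_upwards [he, h1] with r h2 h3
    exact ⟨h2.symm, h3⟩
  · rintro rfl
    rw [hs]
    unfold crossingSign
    dsimp only [HeegaardSplitting.α]
    rw [S.U₀.velocity_circle l x]
    rfl

theorem continuous_α (k : Fin g) : Continuous (S.α k) := S.U₀.continuous_circle S.embedding k

theorem continuous_β (k : Fin g) : Continuous (S.β k) := S.U₁.continuous_circle S.embedding k

theorem α_injective {k l : Fin g} {s t : UnitAddCircle} (h : S.α k s = S.α l t) :
    k = l ∧ s = t := S.U₀.circle_injective h

/-- By transversality the crossings are isolated, and the curves are compact. -/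
theorem finite_crossings [T2Space F] [IsManifold (𝓡 2) ∞ F] (hS : S.Transverse) (k l : Fin g) :
    (S.crossings k l).Finite := by
  have hinj : Set.InjOn Prod.fst (S.crossings k l) := by
    rintro ⟨s, t⟩ h ⟨s', t'⟩ h' (rfl : s = s')
    have : S.α l t = S.α l t' := (show S.β k s = S.α l t from h).symm.trans h'
    rw [(S.α_injective this).2]
  refine Set.Finite.of_finite_image ?_ hinj
  by_contra hinf
  obtain ⟨s, -, hs⟩ := Set.Infinite.exists_accPt_of_subset_isCompact hinf isCompact_univ
    (Set.subset_univ _)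
  have hset : Prod.fst '' S.crossings k l = S.β k ⁻¹' Set.range (S.α l) := by
    ext s
    constructor
    · rintro ⟨⟨s, t⟩, h, rfl⟩
      exact ⟨t, h.symm⟩
    · rintro ⟨t, ht⟩
      exact ⟨(s, t), ht.symm, rfl⟩
  have hcl : IsClosed (Prod.fst '' S.crossings k l) := by
    rw [hset]
    exact (isCompact_range (S.continuous_α l)).isClosed.preimage (S.continuous_β k)
  have hmem : s ∈ Prod.fst '' S.crossings k l := by
    have := hs.clusterPt
    exact hcl.closure_eq ▸ mem_closure_iff_clusterPt.2 this
  obtain ⟨⟨s, t⟩, h, rfl⟩ := hmem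
  obtain ⟨x, rfl⟩ := QuotientAddGroup.mk_surjective t
  obtain ⟨w, w', h0, hw, he, hsign⟩ := S.exists_annulus_coordinates (x := x) (t := 0) (by simp)
    (show S.β k s = _ from h)
  have hw' : w'.2 ≠ 0 := by
    intro h1
    have h2 := hsign rfl
    rw [h1, sign_zero] at h2
    have h3 : SignType.sign (cross (velocity (S.β k) s) (velocity (S.α l) x)) = 0 := by
      unfold crossingSign at h2
      exact signType_coe_eq_zero_iff.1 h2.symm
    exact hS k l s x h (sign_eq_zero_iff.1 h3)
  have hw2 : HasDerivAt (fun r => (w r).2) w'.2 0 := hw.snd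
  have hne : ∀ᶠ r in 𝓝[≠] (0 : ℝ), (w r).2 ≠ 0 := by
    have := hw2.eventually_ne (c := 0) hw'
    simpa [h0] using this
  have hnot : ∀ᶠ r : ℝ in 𝓝[≠] (0 : ℝ), s + (r : UnitAddCircle) ∉ Prod.fst '' S.crossings k l := by
    filter_upwards [hne, he.filter_mono nhdsWithin_le_nhds] with r h1 h2 h3
    rw [hset] at h3
    obtain ⟨t', ht'⟩ := h3
    have h4 := S.U₀.collar_injective (t := Core.mid) (t' := ⟨(w r).2, Set.Ioo_subset_Icc_self h2.2⟩)
      (ht'.trans h2.1)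
    exact h1 (congrArg Subtype.val h4.2.2).symm
  rw [accPt_iff_frequently_nhdsNE] at hs
  refine hs ?_
  rw [eventually_nhdsWithin_iff, ← map_nhds_zero_circle, Filter.eventually_map]
  rw [eventually_nhdsWithin_iff] at hnot
  filter_upwards [hnot] with r h1 h2
  refine h1 ?_
  rintro rfl
  exact h2 (by simp)

end HeegaardSplitting

/-! ### Incidence numbers as signed counts of crossings -/

theorem IsCoverOf.t2Space {G E Y : Type*} [CommGroup G] [TopologicalSpace E] [MulAction G E]
    [TopologicalSpace Y] [T2Space Y] {p : E → Y} {y : Y} {φ : FundamentalGroup Y y →* G}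
    (h : IsCoverOf p y φ) : T2Space E := by
  refine ⟨fun e e' hne => ?_⟩
  have hp := h.isQuotientCoveringMap.isCoveringMap
  by_cases he : p e = p e'
  · exact hp.isSeparatedMap e e' he hne
  · exact separated_by_continuous hp.continuous he

/-- Two lifts of a map that agree at a point agree near that point. -/
theorem eventually_eq_of_lifts {E X A : Type*} [TopologicalSpace E] [TopologicalSpace X]
    [TopologicalSpace A] {p : E → X} (hp : IsLocalHomeomorph p) {f g : A → E} {a : A}
    (hf : ContinuousAt f a) (hg : ContinuousAt g a) (h0 : f a = g a)
    (h : ∀ᶠ x in 𝓝 a, p (f x) = p (g x)) : ∀ᶠ x in 𝓝 a, f x = g x := by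
  obtain ⟨d, hd, rfl⟩ := hp (f a)
  filter_upwards [h, hf.eventually (d.open_source.mem_nhds hd),
    hg.eventually (d.open_source.mem_nhds (h0 ▸ hd))] with x h1 h2 h3
  exact d.injOn h2 h3 h1

section Pinch

variable {E : Type*}

theorem pinch_apply {a : Disc × Core → E} (ha : Function.Injective a) (z : Disc × Core) :
    pinch a (a z) = ((((z.2 : ℝ) + 1) / 2 : ℝ) : UnitAddCircle) := by
  have h : ∃ z', a z' = a z := ⟨z, rfl⟩
  rw [pinch, dif_pos h, ha h.choose_spec]

theorem pinch_of_notMem {a : Disc × Core → E} {y : E} (hy : y ∉ Set.range a) : pinch a y = 0 :=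
  dif_neg hy

theorem pinch_eq_half_iff {a : Disc × Core → E} (ha : Function.Injective a) (y : E) :
    pinch a y = ((1 / 2 : ℝ) : UnitAddCircle) ↔ ∃ x, a (x, Core.mid) = y := by
  constructor
  · intro h
    by_cases hy : y ∈ Set.range a
    · obtain ⟨⟨x, t⟩, rfl⟩ := hy
      rw [pinch_apply ha, unitAddCircle_coe_eq_coe_iff] at h
      obtain ⟨m, hm⟩ := h
      have ht := t.2
      have h1 : (t : ℝ) = 2 * m := by simp only at hm; linarith
      have h2 : m = 0 := by
        have h3 : (-1 : ℝ) ≤ 2 * m := h1 ▸ ht.1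
        have h4 : (2 : ℝ) * m ≤ 1 := h1 ▸ ht.2
        have h5 : -1 ≤ 2 * m := by exact_mod_cast h3
        have h6 : 2 * m ≤ 1 := by exact_mod_cast h4
        omega
      refine ⟨x, ?_⟩
      congr
      exact Subtype.ext (by rw [h1, h2]; simp [Core.mid])
    · rw [pinch_of_notMem hy, ← AddCircle.coe_zero, unitAddCircle_coe_eq_coe_iff] at h
      obtain ⟨m, hm⟩ := h
      have h1 : (2 : ℝ) * m = -1 := by linarith
      have h2 : 2 * m = -1 := by exact_mod_cast h1
      omega
  · rintro ⟨x, rfl⟩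
    rw [pinch_apply ha]
    simp [Core.mid]

theorem continuousOn_pinch_range [TopologicalSpace E] [T2Space E] {a : Disc × Core → E}
    (ha : Function.Injective a) (hc : Continuous a) : ContinuousOn (pinch a) (Set.range a) := by
  have : CompactSpace Disc := isCompact_iff_compactSpace.1 (isCompact_closedBall _ _)
  have he := (hc.isClosedEmbedding ha).isEmbedding
  rw [continuousOn_iff_continuous_domRestrict]
  have h1 : (Set.range a).domRestrict (pinch a) = fun y =>
      (((((he.toHomeomorph.symm y).2 : ℝ) + 1) / 2 : ℝ) : UnitAddCircle) := by
    funext y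
    obtain ⟨z, rfl⟩ := he.toHomeomorph.surjective y
    rw [Homeomorph.symm_apply_apply]
    exact pinch_apply ha z
  rw [h1]
  refine (AddCircle.continuous_mk' _).comp ?_
  fun_prop

end Pinch

namespace EquivariantModel

variable {F Y : Type*} [TopologicalSpace F] [TopologicalSpace Y]
  [ChartedSpace (EuclideanSpace ℝ (Fin 2)) F] {n : ℕ} {S : HeegaardSplitting F Y (n + 1)}
  {x₀ : F} {G : Type*} [CommGroup G] {φ : FundamentalGroup Y (S.ι x₀) →* G}
  (M : EquivariantModel S x₀ φ)

/-- The lift of the circle `α_l` on the boundary of the lifted one-handle. -/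
def αLift (l : Fin (n + 1)) (t : UnitAddCircle) : M.E := M.a l (discBoundary t, Core.mid)

/-- The lift of the circle `β_k` that bounds the lifted two-cell. -/
def βLift (k : Fin (n + 1)) (s : UnitAddCircle) : M.E := M.b k (discBoundary s)

theorem p_smul (h : G) (e : M.E) : M.p (h • e) = M.p e :=
  M.isCover.isQuotientCoveringMap.map_smul h

theorem p_αLift (l : Fin (n + 1)) (t : UnitAddCircle) : M.p (M.αLift l t) = S.ι (S.α l t) :=
  (M.a_lifts _ _).trans (S.U₀.map_circle l t).symm

theorem p_βLift (k : Fin (n + 1)) (s : UnitAddCircle) : M.p (M.βLift k s) = S.ι (S.β k s) :=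
  (M.b_lifts _ _).trans (S.U₁.map_circle k s).symm

theorem continuous_αLift (l : Fin (n + 1)) : Continuous (M.αLift l) := by
  have := continuous_discBoundary
  unfold αLift
  fun_prop

theorem continuous_βLift (k : Fin (n + 1)) : Continuous (M.βLift k) := by
  have := continuous_discBoundary
  unfold βLift
  fun_prop

theorem continuous_smul_a (h : G) (l : Fin (n + 1)) : Continuous fun z => h • M.a l z :=
  (M.isCover.isQuotientCoveringMap.continuous_const_smul h).comp (M.a l).continuous

theorem smul_a_injective (h : G) (l : Fin (n + 1)) : Function.Injective fun z => h • M.a l z := by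
  intro z z' hz
  have := congrArg M.p hz
  simp only [p_smul, a_lifts] at this
  exact (S.U₀.handle_injective₂ this).2

/-- Near a point where the lift of `β_k` runs through the side of a lifted one-handle, this lift is
described by differentiable functions in annulus coordinates. -/
theorem exists_lift_coordinates [IsManifold (𝓡 2) ∞ F] {h : G} {k l : Fin (n + 1)}
    {s : UnitAddCircle} {x : UnitAddCircle} {t : Core} (ht : (t : ℝ) ∈ Set.Ioo (-1 : ℝ) 1)
    (hs : M.βLift k s = h • M.a l (discBoundary x, t)) :
    ∃ (τ : ℝ → ℝ) (c : ℝ), τ 0 = t ∧ HasDerivAt τ c 0 ∧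
      (∀ᶠ r : ℝ in 𝓝 0, ∃ (y : UnitAddCircle) (t' : Core), (t' : ℝ) = τ r ∧
        (t' : ℝ) ∈ Set.Ioo (-1 : ℝ) 1 ∧
        M.βLift k (s + (r : UnitAddCircle)) = h • M.a l (discBoundary y, t')) ∧
      ((t : ℝ) = 0 → (SignType.sign c : ℤ) = S.crossingSign k l (s, x)) := by
  obtain ⟨x, rfl⟩ := QuotientAddGroup.mk_surjective x
  have hF : S.β k s = S.U₀.annulus l (x, t) := by
    refine S.embedding.injective ?_
    rw [← M.p_βLift, hs, p_smul, a_lifts]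
    exact S.U₀.handle_boundary l x t
  obtain ⟨w, w', h0, hw, he, hsign⟩ := S.exists_annulus_coordinates ht hF
  refine ⟨fun r => (w r).2, w'.2, by simp [h0], hw.snd, ?_, hsign⟩
  let J : ℝ → Core := Set.projIcc (-1) 1 (by norm_num)
  have hJ : ∀ u (hu : u ∈ Set.Ioo (-1 : ℝ) 1), J u = ⟨u, Set.Ioo_subset_Icc_self hu⟩ :=
    fun u hu => Set.projIcc_of_mem _ _
  have hJt : J t = t := by rw [hJ t ht]
  have hwc := hw.continuousAt
  have hcont : ContinuousAt
      (fun r => h • M.a l (discBoundary ((w r).1 : UnitAddCircle), J (w r).2)) 0 := by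
    have h1 : Continuous fun z : ℝ × ℝ =>
        h • M.a l (discBoundary (z.1 : UnitAddCircle), J z.2) := by
      refine (M.continuous_smul_a h l).comp (Continuous.prodMk ?_ ?_)
      · exact continuous_discBoundary.comp ((AddCircle.continuous_mk' _).comp continuous_fst)
      · exact continuous_projIcc.comp continuous_snd
    exact h1.continuousAt.comp hwc
  have hβ : Continuous fun r : ℝ => M.βLift k (s + (r : UnitAddCircle)) :=
    (M.continuous_βLift k).comp (continuous_const.add (AddCircle.continuous_mk' _))
  have key := eventually_eq_of_lifts
    M.isCover.isQuotientCoveringMap.isCoveringMap.isLocalHomeomorph hβ.continuousAt hcont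
    (by simpa [h0, hJt] using hs) (by
      filter_upwards [he] with r hr
      rw [p_βLift, p_smul, a_lifts, hr.1, hJ _ hr.2]
      exact (S.U₀.handle_boundary l (w r).1 ⟨(w r).2, _⟩).symm)
  filter_upwards [key, he] with r h1 h2
  refine ⟨(w r).1, J (w r).2, ?_, ?_, h1⟩
  · rw [hJ _ h2.2]
  · rw [hJ _ h2.2]; exact h2.2

theorem exists_eq_discBoundary {h : G} {k l : Fin (n + 1)} {s : UnitAddCircle} {z : Disc × Core}
    (hs : M.βLift k s = h • M.a l z) : ∃ x, discBoundary x = z.1 := by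
  refine exists_discBoundary_eq ((S.U₀.handle_mem_surface_iff l z).1 ⟨S.β k s, ?_⟩)
  rw [← M.p_βLift, hs, p_smul, a_lifts]

theorem continuous_pinch_βLift [IsManifold (𝓡 2) ∞ F] [T2Space Y] (h : G) (k l : Fin (n + 1)) :
    Continuous fun s => pinch (fun z => h • M.a l z) (M.βLift k s) := by
  have := M.isCover.t2Space
  have : CompactSpace Disc := isCompact_iff_compactSpace.1 (isCompact_closedBall _ _)
  let K : Disc × Core → M.E := fun z => h • M.a l z
  have hK : Function.Injective K := M.smul_a_injective h l
  have hKc : Continuous K := M.continuous_smul_a h l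
  let O : Set UnitAddCircle :=
    {s | ∃ z : Disc × Core, (z.2 : ℝ) ∈ Set.Ioo (-1 : ℝ) 1 ∧ M.βLift k s = K z}
  have hO : IsOpen O := by
    rw [isOpen_iff_mem_nhds]
    rintro s ⟨⟨x, t⟩, ht, hs⟩
    obtain ⟨x, rfl⟩ := M.exists_eq_discBoundary hs
    obtain ⟨τ, c, -, -, he, -⟩ := M.exists_lift_coordinates ht hs
    rw [← map_nhds_zero_circle, Filter.mem_map]
    filter_upwards [he] with r hr
    obtain ⟨y, t', -, h1, h2⟩ := hr
    exact ⟨(discBoundary y, t'), h1, h2⟩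
  have h1 : ContinuousOn (fun s => pinch K (M.βLift k s)) (M.βLift k ⁻¹' Set.range K) :=
    (continuousOn_pinch_range hK hKc).comp (M.continuous_βLift k).continuousOn fun _ hx => hx
  -- Off the open annulus the pinched curve stays at the base point.
  have h2 : ContinuousOn (fun s => pinch K (M.βLift k s)) Oᶜ := by
    refine (continuousOn_const (c := (0 : UnitAddCircle))).congr fun s hs => ?_
    by_cases hr : M.βLift k s ∈ Set.range K
    · obtain ⟨z, hz⟩ := hr
      have hz' : ¬ (z.2 : ℝ) ∈ Set.Ioo (-1 : ℝ) 1 := fun h => hs ⟨z, h, hz.symm⟩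
      have h3 : (z.2 : ℝ) = -1 ∨ (z.2 : ℝ) = 1 := by
        by_contra hcon
        push Not at hcon
        exact hz' ⟨lt_of_le_of_ne z.2.2.1 hcon.1.symm, lt_of_le_of_ne z.2.2.2 hcon.2⟩
      simp only [← hz, pinch_apply hK]
      rcases h3 with h3 | h3 <;> rw [h3]
      · norm_num
      · norm_num
    · exact pinch_of_notMem hr
  have h3 := h1.union_of_isClosed h2
    ((isCompact_range hKc).isClosed.preimage (M.continuous_βLift k)) hO.isClosed_compl
  rw [← continuousOn_univ]
  refine h3.mono fun s _ => ?_
  by_cases hs : s ∈ O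
  · obtain ⟨z, -, hz⟩ := hs
    exact Or.inl ⟨z, hz.symm⟩
  · exact Or.inr hs

/-- The incidence number of a lifted two-cell with a lifted one-cell is the signed number of
crossings of the lifts of the attaching circles. -/
theorem incidence_eq_sum [IsManifold (𝓡 2) ∞ F] [T2Space Y] (hS : S.Transverse)
    (h : G) (k l : Fin (n + 1)) (X : Finset (UnitAddCircle × UnitAddCircle))
    (hX : ∀ z, z ∈ X ↔ M.βLift k z.1 = h • M.αLift l z.2) :
    incidence (fun z => h • M.a l z) (M.b k) = ∑ z ∈ X, S.crossingSign k l z := by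
  have hK := M.smul_a_injective h l
  have hinj : ∀ z ∈ X, ∀ z' ∈ X, z.1 = z'.1 → z = z' := by
    intro z hz z' hz' he
    rw [hX] at hz hz'
    rw [he, hz'] at hz
    have := hK hz
    rw [Prod.mk.injEq] at this
    exact Prod.ext he (injective_discBoundary this.1).symm
  have hone : ∀ z ∈ X, ∑ z' ∈ X with z'.1 = z.1, S.crossingSign k l z' = S.crossingSign k l z := by
    intro z hz
    refine Finset.sum_eq_single_of_mem z (by simp [hz]) fun z' hz' hne => ?_
    rw [Finset.mem_filter] at hz'
    exact absurd (hinj z' hz'.1 z hz hz'.2) hne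
  rw [← Finset.sum_fiberwise_of_maps_to (t := X.image Prod.fst)
    (fun z hz => Finset.mem_image_of_mem _ hz)]
  refine circleDegree_eq_sum (M.continuous_pinch_βLift h k l) (X.image Prod.fst) ?_ _ ?_
  · intro s
    rw [pinch_eq_half_iff hK, Finset.mem_image]
    constructor
    · rintro ⟨z, hz, rfl⟩
      exact ⟨_, ((hX z).1 hz).symm⟩
    · rintro ⟨x, hx⟩
      obtain ⟨t, rfl⟩ := M.exists_eq_discBoundary hx.symm
      exact ⟨(s, t), (hX _).2 hx.symm, rfl⟩
  · intro s hs
    obtain ⟨z, hz, rfl⟩ := Finset.mem_image.1 hs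
    have hz' := (hX z).1 hz
    obtain ⟨τ, c, h0, hτ, he, hsign⟩ := M.exists_lift_coordinates (t := Core.mid)
      (by simp [Core.mid]) hz'
    have hc := hsign rfl
    refine ⟨τ, c, by rw [h0]; rfl, hτ, ?_, ?_, ?_⟩
    · rintro rfl
      rw [sign_zero] at hc
      have h1 : S.β k z.1 = S.α l z.2 := by
        refine S.embedding.injective ?_
        rw [← M.p_βLift, hz', p_smul, p_αLift]
      refine hS k l _ _ h1 (sign_eq_zero_iff.1 (signType_coe_eq_zero_iff.1 hc.symm))
    · rw [hone z hz, hc]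
    · filter_upwards [he] with r hr
      obtain ⟨y, t', h1, -, h3⟩ := hr
      rw [h3, ← h1]
      exact pinch_apply hK _

end EquivariantModel

/-! ### Local intersection signs of the tori -/

/-- The columns of the tangent matrix at a point where `β_k` meets `α_{σ k}`, listed block by
block. -/
def blockEquiv {n : ℕ} (σ : Equiv.Perm (Fin n)) : Fin n ⊕ Fin n ≃ Fin n × Fin 2 where
  toFun := Sum.elim (fun k => (σ k, 0)) fun m => (m, 1)
  invFun x := if x.2 = 0 then Sum.inl (σ.symm x.1) else Sum.inr x.1
  left_inv x := by rcases x with k | m <;> simp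
  right_inv x := by
    obtain ⟨m, c⟩ := x
    fin_cases c <;> simp

/-- The permutation that takes the order `β₁, …, βₙ, α₁, …, αₙ` of the tangent vectors of the two
tori to the order of the blocks. -/
def shuffle {n : ℕ} (σ : Equiv.Perm (Fin n)) : Equiv.Perm (Fin (n * 2)) :=
  ((finCongr (Nat.mul_two n)).trans finSumFinEquiv.symm).trans
    ((blockEquiv σ).trans finProdFinEquiv)

/-- The sign that relates the product orientations of the tori to that of the symmetric product. -/
def shuffleSign (n : ℕ) : ℤˣ := Equiv.Perm.sign (shuffle (1 : Equiv.Perm (Fin n)))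

theorem sign_shuffle {n : ℕ} (σ : Equiv.Perm (Fin n)) :
    Equiv.Perm.sign (shuffle σ) = shuffleSign n * Equiv.Perm.sign σ := by
  let f := (finCongr (Nat.mul_two n)).trans finSumFinEquiv.symm
  have h : shuffle σ = shuffle 1 * ((f.trans (Equiv.Perm.sumCongr σ 1)).trans f.symm) := by
    refine Equiv.ext fun x => ?_
    change finProdFinEquiv (blockEquiv σ (f x)) =
      finProdFinEquiv (blockEquiv 1 (f (f.symm (Equiv.Perm.sumCongr σ 1 (f x)))))
    rw [f.apply_symm_apply]
    generalize f x = y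
    rcases y with k | m <;> simp [blockEquiv]
  rw [h, Equiv.Perm.sign_mul]
  congr 1
  simpa only [Equiv.symm_symm, Equiv.Perm.sign_sumCongr, Equiv.Perm.sign_one, mul_one] using
    Equiv.Perm.sign_symm_trans_trans (Equiv.Perm.sumCongr σ (1 : Equiv.Perm (Fin n))) f.symm

theorem sign_units_mul (u : ℤˣ) (x : ℝ) :
    (SignType.sign (((u : ℤ) : ℝ) * x) : ℤ) = u * (SignType.sign x : ℤ) := by
  rcases Int.units_eq_one_or u with rfl | rfl
  · simp
  · simp [Left.sign_neg]

theorem sign_prod {κ : Type*} (s : Finset κ) (f : κ → ℝ) :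
    (SignType.sign (∏ k ∈ s, f k) : ℤ) = ∏ k ∈ s, (SignType.sign (f k) : ℤ) := by
  induction s using Finset.cons_induction with
  | empty => simp
  | cons a s ha ih => rw [Finset.prod_cons, Finset.prod_cons, sign_mul, SignType.coe_mul, ih]

/-- At a point where `β_k` meets `α_{σ k}` for all `k`, the tangent matrix becomes block diagonal
after a permutation of its columns. -/
theorem localSign_eq {F : Type*} [TopologicalSpace F] [ChartedSpace (EuclideanSpace ℝ (Fin 2)) F]
    {n : ℕ} (β α : Fin n → UnitAddCircle → F) (s t : Fin n → UnitAddCircle)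
    (σ : Equiv.Perm (Fin n)) (hσ : ∀ k, β k (s k) = α (σ k) (t (σ k)))
    (hinj : ∀ m m', α m (t m) = α m' (t m') → m = m') :
    localSign β α s t = shuffleSign n * (Equiv.Perm.sign σ : ℤ) *
      ∏ k, (SignType.sign (cross (velocity (β k) (s k)) (velocity (α (σ k)) (t (σ k)))) : ℤ) := by
  let T := tangentMatrix β α s t
  let D : Fin n → Matrix (Fin 2) (Fin 2) ℝ := fun m => Matrix.of fun c c' =>
    if c' = 0 then velocity (β (σ.symm m)) (s (σ.symm m)) c else velocity (α m) (t m) c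
  let B : Matrix (Fin n × Fin 2) (Fin n × Fin 2) ℝ :=
    (Matrix.blockDiagonal D).submatrix (Equiv.prodComm _ _) (Equiv.prodComm _ _)
  have hB : B.submatrix id (blockEquiv σ) = T := by
    ext ⟨m, c⟩ (k | k)
    · have h1 : β k (s k) = α m (t m) ↔ m = σ k := by
        rw [hσ]
        exact ⟨fun h => (hinj _ _ h).symm, fun h => by rw [h]⟩
      by_cases h : m = σ k
      · subst h
        simp [B, T, D, blockEquiv, tangentMatrix, Matrix.blockDiagonal_apply, hσ]
      · simp [B, T, D, blockEquiv, tangentMatrix, Matrix.blockDiagonal_apply, h1, h]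
    · by_cases h : m = k
      · subst h
        simp [B, T, D, blockEquiv, tangentMatrix, Matrix.blockDiagonal_apply]
      · simp [B, T, D, blockEquiv, tangentMatrix, Matrix.blockDiagonal_apply, h, Ne.symm h]
  have hT : T.submatrix (fun r : Fin (n * 2) => finProdFinEquiv.symm r)
      (fun c : Fin (n * 2) => finSumFinEquiv.symm (Fin.cast (Nat.mul_two n) c)) =
      (B.submatrix finProdFinEquiv.symm finProdFinEquiv.symm).submatrix id (shuffle σ) := by
    rw [← hB]
    ext r c
    simp [shuffle]
  have hdet : B.det = ∏ k, cross (velocity (β k) (s k)) (velocity (α (σ k)) (t (σ k))) := by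
    rw [Matrix.det_submatrix_equiv_self, Matrix.det_blockDiagonal, ← Equiv.prod_comp σ]
    refine Finset.prod_congr rfl fun k _ => ?_
    simp [D, Matrix.det_fin_two, cross]
    ring
  unfold localSign
  change (SignType.sign (T.submatrix _ _).det : ℤ) = _
  rw [hT, Matrix.det_permute', Matrix.det_submatrix_equiv_self, hdet, sign_units_mul, sign_prod,
    sign_shuffle]
  push_cast
  rfl

/-! ### Intersection polynomials and minors -/

/-- A group ring element whose coefficients count the elements of the fibres of a map. -/
theorem finsum_single_eq_sum {κ G : Type*} (X : Finset κ) (γ : κ → G) (s : κ → ℤ) (c : G → ℤ)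
    (hc : ∀ h, ∃ X' : Finset κ, (∀ x, x ∈ X' ↔ x ∈ X ∧ γ x = h) ∧ c h = ∑ x ∈ X', s x) :
    ∑ᶠ h : G, MonoidAlgebra.single h (c h) =
      ∑ x ∈ X, (MonoidAlgebra.single (γ x) (s x) : MonoidAlgebra ℤ G) := by
  classical
  have hc' : ∀ h, c h = ∑ x ∈ X with γ x = h, s x := fun h => by
    obtain ⟨X', hX', h1⟩ := hc h
    rw [h1]
    exact Finset.sum_congr (by ext x; simp [hX']) fun _ _ => rfl
  rw [finsum_eq_sum_of_support_subset (s := X.image γ),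
    ← Finset.sum_fiberwise_of_maps_to (t := X.image γ)
      (fun x hx => Finset.mem_image_of_mem _ hx)]
  · refine Finset.sum_congr rfl fun h _ => ?_
    change MonoidAlgebra.singleAddHom h (c h) = _
    rw [hc', map_sum]
    refine Finset.sum_congr rfl fun x hx => ?_
    rw [(Finset.mem_filter.1 hx).2]
    rfl
  · intro h hh
    by_contra hcon
    refine hh ?_
    change MonoidAlgebra.single h (c h) = 0
    rw [hc', Finset.filter_false_of_mem, Finset.sum_empty, MonoidAlgebra.single_zero]
    exact fun x hx he => hcon (he ▸ Finset.mem_coe.2 (Finset.mem_image_of_mem _ hx))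

namespace EquivariantModel

variable {F Y : Type*} [TopologicalSpace F] [TopologicalSpace Y]
  [ChartedSpace (EuclideanSpace ℝ (Fin 2)) F] {n : ℕ} {S : HeegaardSplitting F Y (n + 1)}
  {x₀ : F} {G : Type*} [CommGroup G] {φ : FundamentalGroup Y (S.ι x₀) →* G}
  (M : EquivariantModel S x₀ φ)

theorem smul_left_injective_E {g g' : G} {e : M.E} (h : g • e = g' • e) : g = g' :=
  have := M.isCover.isQuotientCoveringMap.isCancelSMul
  IsCancelSMul.right_cancel _ _ e h

theorem smul_left_injective_P {g g' : G} {e : M.P} (h : g • e = g' • e) : g = g' :=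
  have := M.isSymCover.isQuotientCoveringMap.isCancelSMul
  IsCancelSMul.right_cancel _ _ e h

theorem q_smul (g : G) (Q : M.P) : M.q (g • Q) = M.q Q :=
  M.isSymCover.isQuotientCoveringMap.map_smul g

/-- The element of `G` that relates the lifts of `β_k` and `α_l` over a crossing. -/
theorem exists_crossing_deck : ∃ γ : Fin (n + 1) → Fin (n + 1) → UnitAddCircle × UnitAddCircle → G,
    ∀ k l, ∀ z ∈ S.crossings k l, M.βLift k z.1 = γ k l z • M.αLift l z.2 := by
  have : ∀ k l, ∀ z : UnitAddCircle × UnitAddCircle, ∃ g : G,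
      z ∈ S.crossings k l → M.βLift k z.1 = g • M.αLift l z.2 := by
    intro k l z
    by_cases hz : z ∈ S.crossings k l
    · have : M.p (M.βLift k z.1) = M.p (M.αLift l z.2) := by
        rw [p_βLift, p_αLift, show S.β k z.1 = S.α l z.2 from hz]
      obtain ⟨g, hg⟩ := M.isCover.isQuotientCoveringMap.apply_eq_iff_mem_orbit.1 this
      exact ⟨g, fun _ => hg.symm⟩
    · exact ⟨1, fun h => absurd h hz⟩
  choose γ hγ using this
  exact ⟨γ, hγ⟩

theorem mem_crossings_of_lift {k l : Fin (n + 1)} {z : UnitAddCircle × UnitAddCircle} {g : G}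
    (h : M.βLift k z.1 = g • M.αLift l z.2) : z ∈ S.crossings k l := by
  refine S.embedding.injective ?_
  rw [← M.p_βLift, h, p_smul, p_αLift]

/-- The boundary matrix counts the crossings of the attaching circles. -/
theorem boundaryMatrix_eq_sum [IsManifold (𝓡 2) ∞ F] [T2Space Y] (hS : S.Transverse)
    {γ : Fin (n + 1) → Fin (n + 1) → UnitAddCircle × UnitAddCircle → G}
    (hγ : ∀ k l, ∀ z ∈ S.crossings k l, M.βLift k z.1 = γ k l z • M.αLift l z.2)
    {X : Fin (n + 1) → Fin (n + 1) → Finset (UnitAddCircle × UnitAddCircle)}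
    (hX : ∀ k l z, z ∈ X k l ↔ z ∈ S.crossings k l) (k l : Fin (n + 1)) :
    M.boundaryMatrix l k =
      ∑ z ∈ X k l, MonoidAlgebra.single (γ k l z) (S.crossingSign k l z) := by
  classical
  refine finsum_single_eq_sum (X k l) (γ k l) (S.crossingSign k l) _ fun h => ?_
  refine ⟨{z ∈ X k l | γ k l z = h}, by simp, M.incidence_eq_sum hS h k l _ fun z => ?_⟩
  rw [Finset.mem_filter, hX]
  constructor
  · rintro ⟨hz, rfl⟩
    exact hγ k l z hz
  · intro hz
    have hz' := M.mem_crossings_of_lift hz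
    exact ⟨hz', M.smul_left_injective_E ((hγ k l z hz').symm.trans hz)⟩

/-- The lifts of the tori given by products of points of the lifted circles. Over a common point of
the tori they differ by the product of the deck transformations of the crossings. -/
theorem exists_product_lifts [ConnectedSpace F] :
    ∃ A B : Fin (n + 1) → (Fin n → UnitAddCircle) → M.P,
      (∀ i, M.IsLiftα i (A i)) ∧ (∀ j, M.IsLiftβ j (B j)) ∧
      ∀ i j (σ : Equiv.Perm (Fin n)) (s t : Fin n → UnitAddCircle) (g : Fin n → G),
        (∀ k, M.βLift (j.succAbove k) (s k) =
          g k • M.αLift (i.succAbove (σ k)) (t (σ k))) →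
        B j s = (∏ k, g k) • A i t := by
  have : LocallyPathConnectedSpace F :=
    ChartedSpace.locallyPathConnectedSpace (EuclideanSpace ℝ (Fin 2)) F
  have : PathConnectedSpace F := pathConnectedSpace_iff_connectedSpace.2 inferInstance
  have hE := M.isCover
  have hP := M.isSymCover
  obtain ⟨e₀, he₀⟩ := hE.isQuotientCoveringMap.surjective (S.ι x₀)
  obtain ⟨p₀, hp₀⟩ := hP.isQuotientCoveringMap.surjective (SymProd.mk fun _ => x₀)
  let zα (i : Fin (n + 1)) (t : Fin n → UnitAddCircle) (k : Fin n) : F × M.E :=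
    (S.α (i.succAbove k) (t k), M.αLift (i.succAbove k) (t k))
  let zβ (j : Fin (n + 1)) (s : Fin n → UnitAddCircle) (k : Fin n) : F × M.E :=
    (S.β (j.succAbove k) (s k), M.βLift (j.succAbove k) (s k))
  have hzα : ∀ i t k, M.p (zα i t k).2 = S.ι (zα i t k).1 := fun i t k => M.p_αLift _ _
  have hzβ : ∀ j s k, M.p (zβ j s k).2 = S.ι (zβ j s k).1 := fun j s k => M.p_βLift _ _
  have cα : ∀ i, Continuous (zα i) := fun i => continuous_pi fun k =>
    ((S.continuous_α _).comp (continuous_apply k)).prodMk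
      ((M.continuous_αLift _).comp (continuous_apply k))
  have cβ : ∀ j, Continuous (zβ j) := fun j => continuous_pi fun k =>
    ((S.continuous_β _).comp (continuous_apply k)).prodMk
      ((M.continuous_βLift _).comp (continuous_apply k))
  choose A hA using fun i t =>
    IsProductLift.exists_of_lifts hE hP he₀ hp₀ (zα i t) (hzα i t)
  choose B hB using fun j s =>
    IsProductLift.exists_of_lifts hE hP he₀ hp₀ (zβ j s) (hzβ j s)
  refine ⟨A, B, fun i => ⟨?_, fun t => (hA i t).apply_eq⟩,
    fun j => ⟨?_, fun s => (hB j s).apply_eq⟩, ?_⟩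
  · exact continuous_of_isProductLift hE hP (zα i) (cα i) (hzα i) (A i) (hA i)
  · exact continuous_of_isProductLift hE hP (zβ j) (cβ j) (hzβ j) (B j) (hB j)
  · intro i j σ s t g hg
    have h1 := ((hA i t).comp_perm σ).smul hE hP g
    have h2 : (fun k => (((zα i t ∘ σ) k).1, g k • ((zα i t ∘ σ) k).2)) = zβ j s := by
      funext k
      refine Prod.ext ?_ (hg k).symm
      exact (M.mem_crossings_of_lift (z := (s k, t (σ k))) (hg k)).symm
    rw [h2] at h1
    exact (hB j s).unique hE hP h1

/-- Two lifts of a torus differ by a deck transformation. -/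
theorem exists_smul_eq_of_lifts {A A' : (Fin n → UnitAddCircle) → M.P} (hA : Continuous A)
    (hA' : Continuous A') (h : ∀ t, M.q (A t) = M.q (A' t)) : ∃ u : G, ∀ t, A t = u • A' t := by
  obtain ⟨u, hu⟩ := M.isSymCover.isQuotientCoveringMap.apply_eq_iff_mem_orbit.1 (h 0)
  refine ⟨u, fun t => ?_⟩
  have := M.isSymCover.isQuotientCoveringMap.isCoveringMap.eq_of_comp_eq hA
    ((M.isSymCover.isQuotientCoveringMap.continuous_const_smul u).comp hA')
    (funext fun t => by simp [h, q_smul]) 0 hu.symm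
  exact congrFun this t

/-- If, over every common point of the tori, the lifts `A` and `B` differ by the product of the deck
transformations of the crossings times a constant `c`, the intersection polynomial is the minor
times `c`, up to the sign of the shuffle: the intersection points of the tori are the terms of the
expansion of the determinant. -/
theorem C_eq_smul_Δ [T2Space F] [IsManifold (𝓡 2) ∞ F] [T2Space Y] (hS : S.Transverse)
    {i j : Fin (n + 1)} {A B : (Fin n → UnitAddCircle) → M.P} (hA : M.IsLiftα i A)
    (hB : M.IsLiftβ j B) (c : G)
    (hc : ∀ (σ : Equiv.Perm (Fin n)) (s t : Fin n → UnitAddCircle) (g : Fin n → G),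
      (∀ k, M.βLift (j.succAbove k) (s k) = g k • M.αLift (i.succAbove (σ k)) (t (σ k))) →
      B s = ((∏ k, g k) * c) • A t) :
    M.C i j A B = (shuffleSign n : ℤ) • (MonoidAlgebra.single c (1 : ℤ) * M.Δ i j) := by
  classical
  obtain ⟨γ, hγ⟩ := M.exists_crossing_deck
  let X := fun k l => (S.finite_crossings hS k l).toFinset
  have hX : ∀ k l z, z ∈ X k l ↔ z ∈ S.crossings k l := fun k l z => Set.Finite.mem_toFinset _
  -- A term of the expanded determinant: a permutation and a crossing of `β_k` with `α_{σ k}`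
  -- for each `k`.
  let W : Finset (Σ _ : Equiv.Perm (Fin n), Fin n → UnitAddCircle × UnitAddCircle) :=
    Finset.univ.sigma fun σ => Fintype.piFinset fun k => X (j.succAbove k) (i.succAbove (σ k))
  have hW : ∀ x, x ∈ W ↔
      ∀ k, S.β (j.succAbove k) (x.2 k).1 = S.α (i.succAbove (x.1 k)) (x.2 k).2 := fun x => by
    simp only [W, Finset.mem_sigma, Finset.mem_univ, true_and, Fintype.mem_piFinset, hX]
    rfl
  let Ψ : (Σ _ : Equiv.Perm (Fin n), Fin n → UnitAddCircle × UnitAddCircle) →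
      (Fin n → UnitAddCircle) × (Fin n → UnitAddCircle) := fun x =>
    (fun k => (x.2 k).1, fun m => (x.2 (x.1.symm m)).2)
  let γW : (Σ _ : Equiv.Perm (Fin n), Fin n → UnitAddCircle × UnitAddCircle) → G := fun x =>
    (∏ k, γ (j.succAbove k) (i.succAbove (x.1 k)) (x.2 k)) * c
  have hγW : ∀ x ∈ W, B (Ψ x).1 = γW x • A (Ψ x).2 := by
    intro x hx
    refine hc x.1 _ _ _ fun k => ?_
    simp only [Ψ, Equiv.symm_apply_apply]
    exact hγ _ _ _ ((hW x).1 hx k)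
  have hΨinj : Set.InjOn Ψ W := by
    rintro ⟨σ, y⟩ hx ⟨σ', y'⟩ hx' he
    have hx := (hW _).1 hx
    have hx' := (hW _).1 hx'
    have h1 : ∀ k, (y k).1 = (y' k).1 := fun k => congrFun (congrArg Prod.fst he) k
    have hσ : σ = σ' := by
      ext k : 1
      have h2 := hx k
      rw [h1 k] at h2
      exact Fin.succAbove_right_injective (S.α_injective (h2.symm.trans (hx' k))).1
    subst hσ
    have h2 : ∀ k, (y k).2 = (y' k).2 := fun k => by
      have := congrFun (congrArg Prod.snd he) (σ k)
      simpa [Ψ] using this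
    have : y = y' := funext fun k => Prod.ext (h1 k) (h2 k)
    rw [this]
  have hΨ : ∀ z : (Fin n → UnitAddCircle) × (Fin n → UnitAddCircle), ∀ h : G,
      B z.1 = h • A z.2 → ∃ x ∈ W, Ψ x = z := by
    intro z h hz
    have h1 := congrArg M.q hz
    rw [q_smul, hA.2, hB.2] at h1
    obtain ⟨σ, hσ⟩ := Quotient.exact h1.symm
    have hσ := congrFun hσ
    refine ⟨⟨σ, fun k => (z.1 k, z.2 (σ k))⟩, (hW _).2 hσ, ?_⟩
    simp [Ψ]
  have hsign : ∀ x ∈ W, localSign (fun k => S.β (j.succAbove k)) (fun k => S.α (i.succAbove k))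
      (Ψ x).1 (Ψ x).2 = shuffleSign n * (Equiv.Perm.sign x.1 : ℤ) *
        ∏ k, S.crossingSign (j.succAbove k) (i.succAbove (x.1 k)) (x.2 k) := by
    intro x hx
    rw [localSign_eq _ _ _ _ x.1]
    · simp only [Ψ, Equiv.symm_apply_apply, HeegaardSplitting.crossingSign]
    · intro k
      simpa only [Ψ, Equiv.symm_apply_apply] using (hW x).1 hx k
    · intro m m' h
      exact Fin.succAbove_right_injective (S.α_injective h).1
  have hC : M.C i j A B = ∑ x ∈ W, MonoidAlgebra.single (γW x)
      (shuffleSign n * (Equiv.Perm.sign x.1 : ℤ) *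
        ∏ k, S.crossingSign (j.succAbove k) (i.succAbove (x.1 k)) (x.2 k)) := by
    refine finsum_single_eq_sum W γW _ _ fun h => ⟨{x ∈ W | γW x = h}, by simp, ?_⟩
    unfold intersectionNumber
    rw [finsum_cond_eq_sum_of_cond_iff (fun z => localSign (fun k => S.β (j.succAbove k))
      (fun k => S.α (i.succAbove k)) z.1 z.2) (t := ({x ∈ W | γW x = h}).image Ψ), Finset.sum_image]
    · exact Finset.sum_congr rfl fun x hx => hsign x (Finset.mem_filter.1 hx).1
    · exact hΨinj.mono fun x hx => (Finset.mem_filter.1 hx).1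
    · intro z _
      rw [Finset.mem_image]
      constructor
      · intro hz
        obtain ⟨x, hx, rfl⟩ := hΨ z h hz
        refine ⟨x, Finset.mem_filter.2 ⟨hx, ?_⟩, rfl⟩
        exact M.smul_left_injective_P ((hγW x hx).symm.trans hz)
      · rintro ⟨x, hx, rfl⟩
        obtain ⟨hxW, rfl⟩ := Finset.mem_filter.1 hx
        exact hγW x hxW
  have hΔ : M.Δ i j = ∑ x ∈ W, MonoidAlgebra.single
      (∏ k, γ (j.succAbove k) (i.succAbove (x.1 k)) (x.2 k))
      ((Equiv.Perm.sign x.1 : ℤ) *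
        ∏ k, S.crossingSign (j.succAbove k) (i.succAbove (x.1 k)) (x.2 k)) := by
    unfold Δ
    rw [Matrix.det_apply', Finset.sum_sigma]
    refine Finset.sum_congr rfl fun σ _ => ?_
    simp only [Matrix.submatrix_apply, M.boundaryMatrix_eq_sum hS hγ hX]
    rw [Finset.prod_univ_sum, Finset.mul_sum]
    refine Finset.sum_congr rfl fun y _ => ?_
    rw [MonoidAlgebra.prod_single, ← zsmul_eq_mul, MonoidAlgebra.smul_single, smul_eq_mul]
  rw [hC, hΔ, Finset.mul_sum, Finset.smul_sum]
  refine Finset.sum_congr rfl fun x _ => ?_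
  rw [MonoidAlgebra.single_mul_single, MonoidAlgebra.smul_single, smul_eq_mul, one_mul,
    mul_comm c, mul_assoc]

/-- The comparison of intersection polynomials and minors for an arbitrary coefficient group. -/
theorem exists_sign_C_eq [T2Space F] [ConnectedSpace F] [IsManifold (𝓡 2) ∞ F] [T2Space Y]
    (hS : S.Transverse) : ∃ ε : ℤˣ,
      (∃ A B : Fin (n + 1) → (Fin n → UnitAddCircle) → M.P,
        (∀ i, M.IsLiftα i (A i)) ∧ (∀ j, M.IsLiftβ j (B j)) ∧
        ∀ i j, M.C i j (A i) (B j) = (ε : ℤ) • M.Δ i j) ∧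
      (∀ A B : Fin (n + 1) → (Fin n → UnitAddCircle) → M.P,
        (∀ i, M.IsLiftα i (A i)) → (∀ j, M.IsLiftβ j (B j)) →
        ∃ u v : Fin (n + 1) → G, ∀ i j,
          M.C i j (A i) (B j) =
            (ε : ℤ) • (MonoidAlgebra.single (u i * v j) (1 : ℤ) * M.Δ i j)) := by
  obtain ⟨A₀, B₀, hA₀, hB₀, h₀⟩ := M.exists_product_lifts
  refine ⟨shuffleSign n, ⟨A₀, B₀, hA₀, hB₀, fun i j => ?_⟩, fun A B hA hB => ?_⟩
  · rw [M.C_eq_smul_Δ hS (hA₀ i) (hB₀ j) 1 fun σ s t g hg => by rw [mul_one, h₀ i j σ s t g hg],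
      ← MonoidAlgebra.one_def, one_mul]
  · choose u hu using fun i => M.exists_smul_eq_of_lifts (hA i).1 (hA₀ i).1
      fun t => by rw [(hA i).2, (hA₀ i).2]
    choose v hv using fun j => M.exists_smul_eq_of_lifts (hB j).1 (hB₀ j).1
      fun t => by rw [(hB j).2, (hB₀ j).2]
    refine ⟨fun i => (u i)⁻¹, v, fun i j => ?_⟩
    refine M.C_eq_smul_Δ hS (hA i) (hB j) _ fun σ s t g hg => ?_
    rw [hv, hu, h₀ i j σ s t g hg, ← mul_smul, ← mul_smul]
    congr 1
    rw [mul_assoc, mul_right_comm, inv_mul_cancel, one_mul, mul_comm]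

end EquivariantModel

theorem IsGCD.congr_associated {R κ : Type*} [CommRing R] {x y : κ → R}
    (h : ∀ i, Associated (x i) (y i)) (d : R) : IsGCD x d ↔ IsGCD y d := by
  have hd : ∀ e i, e ∣ x i ↔ e ∣ y i := fun e i => (h i).dvd_iff_dvd_right
  simp only [IsGCD, hd]

theorem associated_zsmul_single_mul {G : Type*} [CommGroup G] (ε : ℤˣ) (g : G)
    (x : MonoidAlgebra ℤ G) :
    Associated x ((ε : ℤ) • (MonoidAlgebra.single g (1 : ℤ) * x)) := by
  have hg : IsUnit (MonoidAlgebra.single g (1 : ℤ) : MonoidAlgebra ℤ G) :=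
    (Group.isUnit g).map (MonoidAlgebra.of ℤ G)
  have hε : IsUnit ((ε : ℤ) : MonoidAlgebra ℤ G) := ε.isUnit.map (Int.castRingHom _)
  rw [zsmul_eq_mul, ← mul_assoc]
  exact (associated_unit_mul_left x _ (hε.mul hg)).symm

end Heegaard

end

theorem mainTheorem9 {F Y : Type*} [TopologicalSpace F] [T2Space F] [CompactSpace F]
    [ConnectedSpace F] [ChartedSpace (EuclideanSpace ℝ (Fin 2)) F] [IsManifold (𝓡 2) ∞ F]
    (hF : IsOrientedAtlas F) [TopologicalSpace Y] [T2Space Y] {n : ℕ}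
    (S : HeegaardSplitting F Y (n + 1)) (hS : S.Transverse) (x₀ : F) :
    (∀ M : EquivariantModel S x₀ (hurewiczFree Y (S.ι x₀)),
      (∃ ε : ℤˣ,
        (∃ A B : Fin (n + 1) → (Fin n → UnitAddCircle) → M.P,
          (∀ i, M.IsLiftα i (A i)) ∧ (∀ j, M.IsLiftβ j (B j)) ∧
          ∀ i j, M.C i j (A i) (B j) = (ε : ℤ) • M.Δ i j) ∧
        (∀ A B : Fin (n + 1) → (Fin n → UnitAddCircle) → M.P,
          (∀ i, M.IsLiftα i (A i)) → (∀ j, M.IsLiftβ j (B j)) →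
          ∃ u v : Fin (n + 1) → H1free Y (S.ι x₀), ∀ i j,
            M.C i j (A i) (B j) =
              (ε : ℤ) • (MonoidAlgebra.single (u i * v j) (1 : ℤ) * M.Δ i j))) ∧
      (∀ A B : Fin (n + 1) → (Fin n → UnitAddCircle) → M.P,
        (∀ i, M.IsLiftα i (A i)) → (∀ j, M.IsLiftβ j (B j)) →
        ∀ d, IsAlexanderPolynomial M d ↔
          IsGCD (fun ij : Fin (n + 1) × Fin (n + 1) =>
            M.C ij.1 ij.2 (A ij.1) (B ij.2)) d)) ∧
    (∀ M : EquivariantModel S x₀ (hurewicz Y (S.ι x₀)),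
      ∃ ε : ℤˣ,
        (∃ A B : Fin (n + 1) → (Fin n → UnitAddCircle) → M.P,
          (∀ i, M.IsLiftα i (A i)) ∧ (∀ j, M.IsLiftβ j (B j)) ∧
          ∀ i j, M.C i j (A i) (B j) = (ε : ℤ) • M.Δ i j) ∧
        (∀ A B : Fin (n + 1) → (Fin n → UnitAddCircle) → M.P,
          (∀ i, M.IsLiftα i (A i)) → (∀ j, M.IsLiftβ j (B j)) →
          ∃ u v : Fin (n + 1) → H1 Y (S.ι x₀), ∀ i j,
            M.C i j (A i) (B j) =
              (ε : ℤ) • (MonoidAlgebra.single (u i * v j) (1 : ℤ) * M.Δ i j))) := by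
  refine ⟨fun M => ?_, fun M => M.exists_sign_C_eq hS⟩
  have h := M.exists_sign_C_eq hS
  refine ⟨h, fun A B hA hB d => ?_⟩
  obtain ⟨ε, -, hε⟩ := h
  obtain ⟨u, v, huv⟩ := hε A B hA hB
  refine IsGCD.congr_associated (fun ij => ?_) d
  rw [huv]
  exact associated_zsmul_single_mul ε _ _
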